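/- **Setting.** Let $\mathcal K$ be an abstract elementary class in a vocabulary $\tau$, let $\kappa=LST(\mathcal K)\ge|\tau|+\aleph_0$, let $\beth_2(\kappa)=2^{2^{\kappa}}$ and $\lambda=\beth_2(\kappa)^{++}$, and suppose that every model in $\mathcal K$ has cardinality at least $\kappa$. Fix pairwise different elements $a^*_\alpha$ ($\alpha<\kappa\cdot\omega$). For $1\le n<\omega$ let $\mathcal S_n$ (the $n$-th level of the canonical tree) be the set of all $N\in\mathcal K$ with universe $\{a^*_\alpha:\alpha<\kappa\cdot n\}$ such that $N\restriction\{a^*_\alpha:\alpha<\kappa\cdot m\}\prec_{\mathcal K}N$ for all $0<m<n$. Let $\bar x_n=\langle x_\alpha:\alpha<\kappa\cdot n\rangle$, $\bar x_{=n}=\langle x_\alpha:\kappa\cdot n\le\alpha<\kappa\cdot(n+1)\rangle$ and $\bar z_{[\kappa]}=\langle z_\alpha:\alpha<\kappa\rangle$. For $N\in\mathcal S_n$ and $\gamma<\lambda^+$ define formulas $\varphi_{N,\gamma,n}(\bar x_n)$ of $\mathbb L_{\lambda^+,\kappa^+}(\tau)$ by induction on $\gamma$: - $\varphi_{N,0,n}$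 is the conjunction of all atomic and negated atomic formulas in the variables $\bar x_n$ that hold in $N$ when each $x_\alpha$ is interpreted as $a^*_\alpha$; - $\varphi_{N,\gamma,n}=\bigwedge_{\beta<\gamma}\varphi_{N,\beta,n}$ for limit $\gamma$; - $\varphi_{N,\beta+1,n}=\forall\bar z_{[\kappa]}\bigvee_{N'\in\mathcal S_{n+1},\,N'\succ_{\mathcal K}N}\exists\bar x_{=n}\Big[\varphi_{N',\beta,n+1}(\bar x_{n+1})\wedge\bigwedge_{\alpha<\kappa}\bigvee_{\delta<\kappa\cdot(n+1)}z_\alpha=x_\delta\Big]$. Let $M_1\subseteq M_2$ be $\tau$-structures. Sequences of length at most $\kappa$ are called short. Consider the conditions: **(A)** $M_1\prec_{\mathcal K}M_2$. **(B)** For all short sequences $\bar a_1$ from $M_1$ and $\bar a_2$ from $M_2$ and all $\gamma<\lambda$ there are short sequences $\bar b_\ell$ from $M_\ell$, models $N_\ell\in\mathcal S_\ell$ and isomorphisms $f_\ell$ from $N_\ell$ onto $M_\ell\restriction\mathrm{Rang}(\bar b_\ell)$ ($\ell=1,2$) such that $\mathrm{Rang}(\bar a_\ell)\subseteq\mathrm{Rang}(\bar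 b_\ell)$, $\mathrm{Rang}(\bar b_1)\subseteq\mathrm{Rang}(\bar b_2)$, $N_1\subseteq N_2$, $f_1\subseteq f_2$, and $M_\ell\models\varphi_{N_\ell,\gamma,\ell}[\langle f_\ell(a^*_\alpha):\alpha<\kappa\cdot\ell\rangle]$ for $\ell=1,2$. **(C)** For every short sequence $\bar a$ from $M_1$ there are a short sequence $\bar b$ from $M_1$, a model $N\in\mathcal S_1$ and an isomorphism $f$ from $N$ onto $M_1\restriction\mathrm{Rang}(\bar b)$ such that $\mathrm{Rang}(\bar a)\subseteq\mathrm{Rang}(\bar b)$ and $M_2\models\varphi_{N,\lambda+1,1}[\langle f(a^*_\alpha):\alpha<\kappa\rangle]$. **Theorem.** If $|M_1|>\kappa$, then (A), (B) and (C) are equivalent. If $|M_2|>\kappa$, then (A) and (C) are equivalent. -/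

import Mathlib

open FirstOrder Cardinal

universe u

/-- Atomic formulas of the vocabulary `L` with variables from `V`. -/
inductive AtomicFormula (L : FirstOrder.Language.{u, u}) (V : Type u) : Type u
  | eq (t s : L.Term V) : AtomicFormula L V
  | rel {k : ℕ} (R : L.Relations k) (ts : Fin k → L.Term V) : AtomicFormula L V

namespace AtomicFormula

variable {L : FirstOrder.Language.{u, u}} {V W : Type u}

/-- Truth of an atomic formula in a structure under an assignment of the variables. -/
def Realize {M : Type u} [L.Structure M] : AtomicFormula L V → (V → M) → Prop
  | eq t s, v => t.realize v = s.realize v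
  | rel R ts, v => FirstOrder.Language.Structure.RelMap R (fun i => (ts i).realize v)

/-- Renaming of variables. -/
def relabel (g : V → W) : AtomicFormula L V → AtomicFormula L W
  | eq t s => eq (t.relabel g) (s.relabel g)
  | rel R ts => rel R (fun i => (ts i).relabel g)

end AtomicFormula

/-- Formulas of the infinitary language `L_{∞,∞}` with (named) variables from `V`: set-sized
conjunctions and disjunctions, and simultaneous quantification over a set of variables. -/
inductive InfFormula (L : FirstOrder.Language.{u, u}) (V : Type u) : Type (u + 1)
  | atom (a : AtomicFormula L V) : InfFormula L V
  | neg (φ : InfFormula L V) : InfFormula L V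
  | and (φ ψ : InfFormula L V) : InfFormula L V
  | conj {ι : Type u} (φ : ι → InfFormula L V) : InfFormula L V
  | disj {ι : Type u} (φ : ι → InfFormula L V) : InfFormula L V
  | all (W : Set V) (φ : InfFormula L V) : InfFormula L V
  | ex (W : Set V) (φ : InfFormula L V) : InfFormula L V

namespace InfFormula

variable {L : FirstOrder.Language.{u, u}} {V : Type u}

/-- Tarskian satisfaction; a quantifier over the block `W` lets the values of the variables in
`W` vary and keeps all the others. -/
def Realize {M : Type u} [L.Structure M] : InfFormula L V → (V → M) → Prop
  | atom a, v => a.Realize v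
  | neg φ, v => ¬ φ.Realize v
  | and φ ψ, v => φ.Realize v ∧ ψ.Realize v
  | conj φ, v => ∀ i, (φ i).Realize v
  | disj φ, v => ∃ i, (φ i).Realize v
  | all W φ, v => ∀ w : V → M, (∀ x, x ∉ W → w x = v x) → φ.Realize w
  | ex W φ, v => ∃ w : V → M, (∀ x, x ∉ W → w x = v x) ∧ φ.Realize w

/-- Membership in the logic `L_{μ,θ}`: conjunctions and disjunctions of fewer than `μ` formulas,
quantification over fewer than `θ` variables at a time. -/
def InLogic (μ θ : Cardinal.{u}) : InfFormula L V → Prop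
  | atom _ => True
  | neg φ => φ.InLogic μ θ
  | and φ ψ => φ.InLogic μ θ ∧ ψ.InLogic μ θ
  | @conj _ _ ι φ => #ι < μ ∧ ∀ i, (φ i).InLogic μ θ
  | @disj _ _ ι φ => #ι < μ ∧ ∀ i, (φ i).InLogic μ θ
  | all W φ => #W < θ ∧ φ.InLogic μ θ
  | ex W φ => #W < θ ∧ φ.InLogic μ θ

end InfFormula

/-- A sequence of elements of `M` of length an ordinal `≤ κ`. -/
structure ShortSeq (κ : Cardinal.{u}) (M : Type u) where
  len : Ordinal.{u}
  len_le : len ≤ κ.ord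
  val : len.ToType → M

/-- The range of a sequence. -/
def ShortSeq.rang {κ : Cardinal.{u}} {M : Type u} (a : ShortSeq κ M) : Set M :=
  Set.range a.val

/-- An abstract elementary class in the vocabulary `L`: a class of `L`-structures (`Mem`), with
a relation between the members and their substructures: `Strong S`, for a substructure `S` of a
structure `N`, says that `S ≺ N`. -/
structure AbstractElementaryClass (L : FirstOrder.Language.{u, u}) where
  Mem : ∀ (M : Type u) [L.Structure M], Prop
  Strong : ∀ {N : Type u} [L.Structure N], L.Substructure N → Prop
  /-- The class is closed under isomorphism. -/
  mem_iso : ∀ {M N : Type u} [L.Structure M] [L.Structure N], (M ≃[L] N) → Mem M → Mem N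
  /-- The relation is closed under isomorphism. -/
  strong_iso : ∀ {M N : Type u} [L.Structure M] [L.Structure N] (e : M ≃[L] N)
    (S : L.Substructure M), Strong S → Strong (S.map e.toHom)
  /-- The relation holds only between members of the class. -/
  mem_of_strong : ∀ {N : Type u} [L.Structure N] (S : L.Substructure N),
    Strong S → Mem S ∧ Mem N
  /-- Reflexivity. -/
  strong_refl : ∀ {N : Type u} [L.Structure N], Mem N → Strong (⊤ : L.Substructure N)
  /-- Transitivity: `P ≺ S ≺ N` implies `P ≺ N`. -/
  strong_trans : ∀ {N : Type u} [L.Structure N] (S : L.Substructure N) (P : L.Substructure S),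
    Strong P → Strong S → Strong (P.map S.subtype.toHom)
  /-- Coherence: if `S ⊆ T`, `S ≺ N` and `T ≺ N`, then `S ≺ T`. -/
  coherence : ∀ {N : Type u} [L.Structure N] (S T : L.Substructure N), S ≤ T →
    Strong S → Strong T → Strong (S.comap T.subtype.toHom)
  /-- The union `N` of a `≺`-increasing continuous chain of limit length is in the class and is
  a `≺`-extension of every member of the chain. -/
  chain_union : ∀ {N : Type u} [L.Structure N] (δ : Ordinal.{u}) (S : Ordinal.{u} → L.Substructure N),
    Order.IsSuccLimit δ →
    (∀ i j, i < j → j < δ → S i ≤ S j ∧ Strong ((S i).comap (S j).subtype.toHom)) →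
    (∀ j, j < δ → Order.IsSuccLimit j → (S j : Set N) = ⋃ i < j, (S i : Set N)) →
    (⋃ i < δ, (S i : Set N)) = Set.univ →
    Mem N ∧ ∀ i < δ, Strong (S i)
  /-- If all members of a `≺`-increasing continuous chain are `≺ N`, then so is the union `T`
  of the chain. -/
  chain_smooth : ∀ {N : Type u} [L.Structure N] (δ : Ordinal.{u}) (S : Ordinal.{u} → L.Substructure N)
    (T : L.Substructure N), Order.IsSuccLimit δ →
    (∀ i j, i < j → j < δ → S i ≤ S j ∧ Strong ((S i).comap (S j).subtype.toHom)) →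
    (∀ j, j < δ → Order.IsSuccLimit j → (S j : Set N) = ⋃ i < j, (S i : Set N)) →
    (T : Set N) = ⋃ i < δ, (S i : Set N) →
    (∀ i < δ, Strong (S i)) → Strong T
  /-- The Löwenheim-Skolem-Tarski axiom. -/
  exists_lst : ∃ κ : Cardinal.{u}, ℵ₀ ≤ κ ∧ L.card ≤ κ ∧
    ∀ {N : Type u} [L.Structure N], Mem N → ∀ A : Set N,
      ∃ S : L.Substructure N, Strong S ∧ A ⊆ S ∧ #S ≤ #A + κ

namespace AbstractElementaryClass

variable {L : FirstOrder.Language.{u, u}} (K : AbstractElementaryClass L)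

/-- The Löwenheim-Skolem-Tarski number `κ = LST(K)`: the least infinite cardinal `κ ≥ |τ|` as in
the Löwenheim-Skolem-Tarski axiom. -/
noncomputable def lst : Cardinal.{u} :=
  sInf {κ : Cardinal.{u} | ℵ₀ ≤ κ ∧ L.card ≤ κ ∧
    ∀ {N : Type u} [L.Structure N], K.Mem N → ∀ A : Set N,
      ∃ S : L.Substructure N, K.Strong S ∧ A ⊆ S ∧ #S ≤ #A + κ}

/-- The cardinal `λ = ℶ₂(κ)⁺⁺`, where `ℶ₂(κ) = 2 ^ (2 ^ κ)`. -/
noncomputable def lam : Cardinal.{u} :=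
  Order.succ (Order.succ (2 ^ ((2 : Cardinal.{u}) ^ K.lst)))

/-- A well-ordered index set of order type `κ`. -/
abbrev Idx : Type u := K.lst.ord.ToType

/-- The set `{a*_α : α < κ · n}` of pairwise different elements. An ordinal `α < κ · ω` is
uniquely `κ · i + ζ` with `i < ω` and `ζ < κ`, and the pair `(i, ζ)` is used for `a*_α`; then
`α < κ · n` means `i < n`. -/
abbrev Univ (n : ℕ) : Type u := {p : ℕ × K.Idx // p.1 < n}

/-- The level `S_n` of the canonical tree, for `n ≥ 1` (the root `S_0`, which only has the
conventional empty model, is not needed): the structures `N` in the class with universe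
`{a*_α : α < κ · n}` such that the restriction of `N` to `{a*_α : α < κ · m}` is a
`≺`-substructure of `N` for all `0 < m < n`. -/
structure Node (n : ℕ) where
  str : L.Structure (K.Univ n)
  mem : K.Mem (K.Univ n)
  strong : ∀ m, 0 < m → m < n → ∃ P : L.Substructure (K.Univ n),
    (P : Set (K.Univ n)) = {p | p.1.1 < m} ∧ K.Strong P

variable {K}

/-- The model `N` of the canonical tree as a type. -/
def Node.Carrier {n : ℕ} (_N : K.Node n) : Type u := K.Univ n

instance {n : ℕ} : CoeSort (K.Node n) (Type u) := ⟨Node.Carrier⟩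

instance {n : ℕ} (N : K.Node n) : L.Structure N := N.str

/-- The element `a*_α` of a model `N` in the canonical tree. -/
def Node.elt {n : ℕ} (N : K.Node n) (p : K.Univ n) : N := p

/-- `M ⊆ N` for models of the canonical tree: the inclusion map is an embedding. -/
def Node.Sub {m n : ℕ} (M : K.Node m) (N : K.Node n) : Prop :=
  ∃ (h : m ≤ n) (g : M ↪[L] N),
    ∀ p : K.Univ m, g (M.elt p) = N.elt ⟨p.1, p.2.trans_le h⟩

/-- `M ≺ N` for models of the canonical tree. -/
def Node.StrongSub {m n : ℕ} (M : K.Node m) (N : K.Node n) : Prop :=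
  ∃ (h : m ≤ n) (g : M ↪[L] N),
    (∀ p : K.Univ m, g (M.elt p) = N.elt ⟨p.1, p.2.trans_le h⟩) ∧ K.Strong g.toHom.range

variable (K)

/-- The variables: `x_α` for `α < κ · ω` (with `α = κ · i + ζ` coded by `(i, ζ)`, as for the
elements `a*_α`) and `z_ζ` for `ζ < κ`. -/
inductive Var : Type u
  | x (p : ℕ × K.Idx) : Var
  | z (ζ : K.Idx) : Var

/-- The block `x̄_{=n}` of the variables `x_α`, `κ · n ≤ α < κ · (n + 1)`. -/
def xBlock (n : ℕ) : Set K.Var := Set.range fun ζ : K.Idx => Var.x (n, ζ)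

/-- The block `z̄_[κ]`. -/
def zBlock : Set K.Var := Set.range (Var.z : K.Idx → K.Var)

/-- The formula `v = w` for variables `v`, `w`. -/
def varEq (v w : K.Var) : InfFormula L K.Var :=
  InfFormula.atom (AtomicFormula.eq (FirstOrder.Language.Term.var v) (FirstOrder.Language.Term.var w))

variable {K}

open Classical in
/-- The conjunction of the diagram of `N`: of all atomic and negated atomic formulas in the
variables `x_α`, `α < κ · n`, that hold in `N` when `x_α` is interpreted as `a*_α`. -/
noncomputable def Node.diag {n : ℕ} (N : K.Node n) : InfFormula L K.Var :=
  InfFormula.conj fun a : AtomicFormula L (K.Univ n) =>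
    if a.Realize N.elt then InfFormula.atom (a.relabel fun p => Var.x p.1)
    else InfFormula.neg (InfFormula.atom (a.relabel fun p => Var.x p.1))

/-- The formula `φ_{M,γ,n}(x̄_n)`, for an ordinal `γ` and `M` in the level `S_n`, `n ≥ 1`, by
recursion on `γ`: at `0` the diagram of `M`, at a limit the conjunction of the earlier formulas,
and at `β + 1` the formula
`∀ z̄_[κ] ⋁_{N ∈ S_{n+1}, N ≻ M} ∃ x̄_{=n} [φ_{N,β,n+1}(x̄_{n+1}) ∧ ⋀_ζ ⋁_{δ < κ(n+1)} z_ζ = x_δ]`. -/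
noncomputable def phi (γ : Ordinal.{u}) : ∀ n : ℕ, K.Node n → InfFormula L K.Var :=
  Ordinal.limitRecOn (motive := fun _ => ∀ n : ℕ, K.Node n → InfFormula L K.Var) γ
    (fun _ M => M.diag)
    (fun _ IH n M =>
      InfFormula.all K.zBlock (InfFormula.disj fun N : {N : K.Node (n + 1) // M.StrongSub N} =>
        InfFormula.ex (K.xBlock n) (InfFormula.and (IH (n + 1) N.1)
          (InfFormula.conj fun ζ : K.Idx => InfFormula.disj fun p : K.Univ (n + 1) =>
            K.varEq (Var.z ζ) (Var.x p.1)))))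
    (fun γ _ IH n M => InfFormula.conj fun β : γ.ToType => IH β.toOrd.1 β.toOrd.2 n M)

/-- `M ⊨ φ_{N,γ,n}[⟨f(a*_α) : α < κ · n⟩]`: the formula holds whenever each `x_α`, `α < κ · n`,
is interpreted as `f(a*_α)` (the other variables are not free in the formula). -/
def SatPhi {n : ℕ} (N : K.Node n) (γ : Ordinal.{u}) {M : Type u} [L.Structure M] (f : N → M) :
    Prop :=
  ∀ v : K.Var → M, (∀ p : K.Univ n, v (Var.x p.1) = f (N.elt p)) → (phi γ n N).Realize v

variable (K)

/-- Condition (B), for `τ`-structures `M₁ ⊆ M₂`. An isomorphism of `N` onto the substructure of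
`M` with universe `Rang(b̄)` is an embedding of `N` into `M` with range `Rang(b̄)`. -/
def CondB {M₂ : Type u} [L.Structure M₂] (M₁ : L.Substructure M₂) : Prop :=
  ∀ (a₁ : ShortSeq K.lst M₁) (a₂ : ShortSeq K.lst M₂) (γ : Ordinal.{u}), γ < K.lam.ord →
    ∃ (b₁ : ShortSeq K.lst M₁) (b₂ : ShortSeq K.lst M₂) (N₁ : K.Node 1) (N₂ : K.Node 2)
      (f₁ : N₁ ↪[L] M₁) (f₂ : N₂ ↪[L] M₂),
      a₁.rang ⊆ b₁.rang ∧ a₂.rang ⊆ b₂.rang ∧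
      Set.range f₁ = b₁.rang ∧ Set.range f₂ = b₂.rang ∧
      (∀ y : M₁, y ∈ b₁.rang → (y : M₂) ∈ b₂.rang) ∧
      N₁.Sub N₂ ∧
      (∀ p : K.Univ 1,
        (f₁ (N₁.elt p) : M₂) = f₂ (N₂.elt ⟨p.1, p.2.trans one_lt_two⟩)) ∧
      SatPhi N₁ γ f₁ ∧ SatPhi N₂ γ f₂

/-- Condition (C), for `τ`-structures `M₁ ⊆ M₂`. -/
def CondC {M₂ : Type u} [L.Structure M₂] (M₁ : L.Substructure M₂) : Prop :=
  ∀ a : ShortSeq K.lst M₁,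
    ∃ (b : ShortSeq K.lst M₁) (N : K.Node 1) (f : N ↪[L] M₁),
      a.rang ⊆ b.rang ∧ Set.range f = b.rang ∧
      SatPhi N (K.lam.ord + 1) (fun y => (f y : M₂))

/-! The formulas `φ_{M,γ,n}`, `γ < λ⁺`, belong to the logic `L_{λ⁺,κ⁺}(τ)`. -/

theorem lst_spec : ℵ₀ ≤ K.lst ∧ L.card ≤ K.lst ∧
    ∀ {N : Type u} [L.Structure N], K.Mem N → ∀ A : Set N,
      ∃ S : L.Substructure N, K.Strong S ∧ A ⊆ S ∧ #S ≤ #A + K.lst :=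
  csInf_mem (s := {κ : Cardinal.{u} | ℵ₀ ≤ κ ∧ L.card ≤ κ ∧
    ∀ {N : Type u} [L.Structure N], K.Mem N → ∀ A : Set N,
      ∃ S : L.Substructure N, K.Strong S ∧ A ⊆ S ∧ #S ≤ #A + κ}) K.exists_lst

theorem mk_univ_le (n : ℕ) : #(K.Univ n) ≤ K.lst := by
  refine (mk_subtype_le _).trans ?_
  rw [mk_prod]
  simp only [mk_ord_toType, lift_uzero, mk_nat, lift_aleph0]
  exact (mul_le_mul_left K.lst_spec.1 _).trans (mul_eq_self K.lst_spec.1).le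

theorem mk_fun_le (n k : ℕ) : #(Fin k → K.Univ n) ≤ K.lst := by
  rw [mk_pi]; simp only [prod_const, lift_uzero, mk_fin]
  simp only [lift_natCast, power_natCast]
  exact (pow_le_pow_left' (K.mk_univ_le n) _).trans (power_nat_le K.lst_spec.1)

theorem mk_functions_le : #(Σ k, L.Functions k) ≤ K.lst :=
  le_trans (by rw [FirstOrder.Language.card, FirstOrder.Language.Symbols, mk_sum]; simp) K.lst_spec.2.1

theorem mk_relations_le : #(Σ k, L.Relations k) ≤ K.lst :=
  le_trans (by rw [FirstOrder.Language.card, FirstOrder.Language.Symbols, mk_sum]; simp) K.lst_spec.2.1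

theorem mk_sigma_le {ι : Type u} {α : ι → Type u} (h : #ι ≤ K.lst) (h' : ∀ i, #(α i) ≤ K.lst) :
    #(Σ i, α i) ≤ K.lst := by
  rw [mk_sigma]
  refine (sum_le_sum _ _ h').trans ?_
  rw [sum_const, lift_id, lift_id]
  exact (mul_le_mul_left h _).trans (mul_eq_self K.lst_spec.1).le

theorem mk_term_le (n : ℕ) : #(L.Term (K.Univ n)) ≤ K.lst := by
  refine FirstOrder.Language.Term.card_le.trans (max_le K.lst_spec.1 ?_)
  rw [mk_sum, lift_id, lift_id]
  exact add_le_of_le K.lst_spec.1 (K.mk_univ_le n) K.mk_functions_le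

theorem mk_atomic_le (n : ℕ) : #(AtomicFormula L (K.Univ n)) ≤ K.lst := by
  let F : AtomicFormula L (K.Univ n) → (L.Term (K.Univ n) × L.Term (K.Univ n)) ⊕
      (Σ R : (Σ k, L.Relations k), Fin R.1 → L.Term (K.Univ n))
    | .eq t s => .inl (t, s)
    | .rel R ts => .inr ⟨⟨_, R⟩, ts⟩
  have hF : Function.Injective F := by
    rintro (⟨t, s⟩ | ⟨R, ts⟩) (⟨t', s'⟩ | ⟨R', ts'⟩) h
    · simp [F] at h; simp [h]
    · simp [F] at h
    · simp [F] at h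
    · simp only [F, Sum.inr.injEq, Sigma.mk.injEq] at h
      obtain ⟨⟨h1, h2⟩, h3⟩ := h
      subst h1; cases h2; cases h3; rfl
  refine (mk_le_of_injective hF).trans ?_
  rw [mk_sum, lift_id, lift_id]
  refine add_le_of_le K.lst_spec.1 ?_ ?_
  · rw [← mul_def]
    exact (mul_le_mul' (K.mk_term_le n) (K.mk_term_le n)).trans (mul_eq_self K.lst_spec.1).le
  · refine K.mk_sigma_le K.mk_relations_le fun R => ?_
    rw [mk_pi]; simp only [prod_const, lift_uzero, mk_fin, lift_natCast, power_natCast]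
    exact (pow_le_pow_left' (K.mk_term_le n) _).trans (power_nat_le K.lst_spec.1)

theorem mk_node_le (n : ℕ) : #(K.Node n) ≤ 2 ^ K.lst := by
  let F : K.Node n → ((Σ R : (Σ k, L.Functions k), Fin R.1 → K.Univ n) → K.Univ n) ×
      Set (Σ R : (Σ k, L.Relations k), Fin R.1 → K.Univ n) := fun N =>
    (fun x => @FirstOrder.Language.Structure.funMap L _ N.str _ x.1.2 x.2,
      {x | @FirstOrder.Language.Structure.RelMap L _ N.str _ x.1.2 x.2})
  have hF : Function.Injective F := by
    rintro ⟨N, hN, hN'⟩ ⟨N', h1, h2⟩ h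
    have : N = N' := by
      simp only [F, Prod.mk.injEq] at h
      ext k f x
      · exact congrArg (fun p => p.1.1) (congrFun h.1 ⟨⟨k, f⟩, x⟩)
      · exact congrArg (fun p => p.1.2) (congrFun h.1 ⟨⟨k, f⟩, x⟩)
      · exact Set.ext_iff.1 h.2 ⟨⟨k, f⟩, x⟩
    subst this; rfl
  refine (mk_le_of_injective hF).trans ?_
  have hle : K.lst ≤ 2 ^ K.lst := (cantor _).le
  rw [mk_prod, lift_id, lift_id, mk_set, ← power_def]
  have e1 := K.mk_sigma_le K.mk_functions_le fun R => K.mk_fun_le n R.1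
  have e2 := K.mk_sigma_le K.mk_relations_le fun R => K.mk_fun_le n R.1
  refine (mul_le_mul' (b := 2 ^ K.lst) (d := 2 ^ K.lst) ?_ (power_le_power_left two_ne_zero e2)).trans
    (mul_eq_self (K.lst_spec.1.trans hle)).le
  calc #(K.Univ n) ^ #(Σ R : (Σ k, L.Functions k), Fin R.1 → K.Univ n)
      ≤ K.lst ^ #(Σ R : (Σ k, L.Functions k), Fin R.1 → K.Univ n) :=
        power_le_power_right (K.mk_univ_le n)
    _ ≤ K.lst ^ K.lst := power_le_power_left (aleph0_pos.trans_le K.lst_spec.1).ne' e1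
    _ = 2 ^ K.lst := power_self_eq K.lst_spec.1

theorem lst_lt_lam : (2 : Cardinal) ^ K.lst < K.lam :=
  (cantor _).trans ((Order.lt_succ _).trans (Order.lt_succ _))

/-- `φ_{M,γ,n}` is a formula of `L_{λ⁺,κ⁺}(τ)` for all `γ < λ⁺`. -/
theorem phi_inLogic (γ : Ordinal.{u}) (hγ : γ < (Order.succ K.lam).ord) (n : ℕ) (M : K.Node n) :
    (phi γ n M).InLogic (Order.succ K.lam) (Order.succ K.lst) := by
  have h2 : (2 : Cardinal) ^ K.lst < Order.succ K.lam := K.lst_lt_lam.trans (Order.lt_succ _)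
  have h1 : K.lst < Order.succ K.lam := (cantor _).trans h2
  induction γ using Ordinal.limitRecOn generalizing n with
  | zero =>
    rw [phi, Ordinal.limitRecOn_zero]
    refine ⟨(K.mk_atomic_le n).trans_lt h1, fun a => ?_⟩
    by_cases h : a.Realize M.elt <;> simp [h, InfFormula.InLogic]
  | add_one β IH =>
    rw [phi, Ordinal.limitRecOn_add_one]
    have hβ := IH ((lt_add_one β).trans hγ)
    refine ⟨Order.lt_succ_of_le ?_, ((mk_subtype_le _).trans (K.mk_node_le _)).trans_lt h2,
      fun N => ⟨Order.lt_succ_of_le ?_, hβ _ _, by simpa using h1,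
        fun ζ => ⟨(K.mk_univ_le _).trans_lt h1, fun _ => trivial⟩⟩⟩
    · exact mk_range_le.trans (by simp)
    · exact mk_range_le.trans (by simp)
  | limit γ hl IH =>
    rw [phi, Ordinal.limitRecOn_limit _ _ _ _ hl]
    refine ⟨by rw [mk_toType]; exact lt_ord.1 hγ, fun β => IH _ β.toOrd.2 (lt_trans β.toOrd.2 hγ) _ _⟩

end AbstractElementaryClass

/-! Write `μ = (2 ^ κ)⁺`, a regular cardinal below `λ`.

From (A) to (B) and (C): if a node of the tree is strongly embedded in a model with more than `κ`
elements, its image satisfies its formulas of every rank (`sem_of_strongEmb`). By Löwenheim-Skolem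
the image and any `κ` further elements lie in a strong submodel with exactly `κ` new elements, which
is the image of a node of the next level (`exists_node_extension`).

The converse rests on `strongLE_of_sem`: of two submodels of `M` satisfying their formulas of rank
`μ`, one included in the other, the smaller is `≺` the larger. If `N ⊆ N'` have copies in `M` of
every rank below `μ`, then for each `γ < μ` the formula of rank `γ + 1` of `N` gives some `N₂ ≻ N`
of rank `γ` whose copy contains that of `N'`. There are only `2 ^ κ` possible inclusions `N' ⊆ N₂`,
so one of them occurs for all `γ < μ`, and the pair `N' ⊆ N₂` inherits the assumption. Iterating
gives `N ⊆ N' ⊆ N₂ ⊆ N₃ ⊆ ...` in which two-step inclusions are strong. The even and the odd members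
are `≺`-chains with the same limit, hence all are strong in it, and coherence yields `N ≺ N'`
(`strongEmb_of_interlaced`).

Under (B) or (C) these submodels of `M₂` cover every subset of size at most `κ`. Directed unions
(`strongLE_of_cofinal`) then make each of them `≺ M₂`, and exhibit `M₁` as a directed union of
strong submodels of `M₂`, so `M₁ ≺ M₂`. -/

namespace AbstractElementaryClass

open FirstOrder.Language FirstOrder.Language.Substructure

/-! ### The axioms in terms of embeddings, and interlaced chains -/

section StrongEmbeddings

variable {L : FirstOrder.Language.{u, u}} (K : AbstractElementaryClass L)

/-- An embedding is strong if its range is a `≺`-substructure of the codomain. -/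
def StrongEmb {M N : Type u} [L.Structure M] [L.Structure N] (g : M ↪[L] N) : Prop :=
  K.Strong g.toHom.range

/-- `S ≺ T` for substructures `S`, `T` of a structure. -/
def StrongLE {N : Type u} [L.Structure N] (S T : L.Substructure N) : Prop :=
  ∃ h : S ≤ T, K.StrongEmb (inclusion h)

variable {K}

variable {A B C : Type u} [L.Structure A] [L.Structure B] [L.Structure C]

theorem strongEmb_subtype {S : L.Substructure A} : K.StrongEmb S.subtype ↔ K.Strong S := by
  rw [StrongEmb, range_subtype]

theorem StrongEmb.equiv_comp {g : A ↪[L] B} (hg : K.StrongEmb g) (e : B ≃[L] C) :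
    K.StrongEmb (e.toEmbedding.comp g) := by
  have h := K.strong_iso e _ hg
  rw [← Hom.range_comp] at h
  exact h

theorem StrongEmb.comp_equiv {g : B ↪[L] C} (hg : K.StrongEmb g) (e : A ≃[L] B) :
    K.StrongEmb (g.comp e.toEmbedding) := by
  have : (g.comp e.toEmbedding).toHom.range = g.toHom.range := by
    ext x
    simp only [Hom.mem_range]
    exact ⟨fun ⟨y, hy⟩ => ⟨e y, hy⟩, fun ⟨y, hy⟩ => ⟨e.symm y, by rw [← hy]; simp⟩⟩
  rw [StrongEmb, this]
  exact hg

/-- The transitivity axiom concerns a substructure of a substructure, so the range of `f` is first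
carried into the range of `g`. -/
theorem StrongEmb.comp {g : B ↪[L] C} {f : A ↪[L] B} (hg : K.StrongEmb g) (hf : K.StrongEmb f) :
    K.StrongEmb (g.comp f) := by
  have h := K.strong_trans _ _ (K.strong_iso g.equivRange _ hf) hg
  have e : ((f.toHom.range.map g.equivRange.toHom).map g.toHom.range.subtype.toHom) =
      (g.comp f).toHom.range := by
    ext x
    simp only [Substructure.mem_map, Hom.mem_range]
    constructor
    · rintro ⟨_, ⟨_, ⟨y, rfl⟩, rfl⟩, rfl⟩
      exact ⟨y, rfl⟩
    · rintro ⟨y, rfl⟩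
      exact ⟨_, ⟨_, ⟨y, rfl⟩, rfl⟩, rfl⟩
  rw [e] at h
  exact h

/-- This is coherence inside `C`, pulled back along the isomorphism of `B` with the range of `g`. -/
theorem StrongEmb.of_comp {g : B ↪[L] C} {f : A ↪[L] B} (hgf : K.StrongEmb (g.comp f))
    (hg : K.StrongEmb g) : K.StrongEmb f := by
  have hle : (g.comp f).toHom.range ≤ g.toHom.range := by
    rintro _ ⟨y, rfl⟩
    exact ⟨f y, rfl⟩
  have h := K.strong_iso g.equivRange.symm _ (K.coherence _ _ hle hgf hg)
  have e : (((g.comp f).toHom.range.comap g.toHom.range.subtype.toHom).map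
      g.equivRange.symm.toHom) = f.toHom.range := by
    ext x
    simp only [Substructure.mem_map, Hom.mem_range, Substructure.mem_comap]
    constructor
    · rintro ⟨z, ⟨y, hy⟩, rfl⟩
      refine ⟨y, ?_⟩
      have : z = g.equivRange (f y) := Subtype.ext hy.symm
      rw [this]
      exact (g.equivRange.symm_apply_apply (f y)).symm
    · rintro ⟨y, rfl⟩
      exact ⟨g.equivRange (f y), ⟨y, rfl⟩, g.equivRange.symm_apply_apply (f y)⟩
  rw [e] at h
  exact h

theorem StrongEmb.mem_cod {f : A ↪[L] B} (hf : K.StrongEmb f) : K.Mem B :=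
  (K.mem_of_strong _ hf).2

theorem comap_subtype_eq_range {S T : L.Substructure A} (h : S ≤ T) :
    S.comap T.subtype.toHom = (inclusion h).toHom.range := by
  ext x
  simp only [Substructure.mem_comap, Hom.mem_range]
  exact ⟨fun hx => ⟨⟨_, hx⟩, rfl⟩, fun ⟨y, hy⟩ => by rw [← hy]; exact y.2⟩

theorem strongLE_iff {S T : L.Substructure A} :
    K.StrongLE S T ↔ S ≤ T ∧ K.Strong (S.comap T.subtype.toHom) :=
  ⟨fun ⟨h, hs⟩ => ⟨h, by rw [comap_subtype_eq_range h]; exact hs⟩,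
    fun ⟨h, hs⟩ => ⟨h, by rw [comap_subtype_eq_range h] at hs; exact hs⟩⟩

theorem StrongLE.trans {S T R : L.Substructure A} (h : K.StrongLE S T) (h' : K.StrongLE T R) :
    K.StrongLE S R :=
  ⟨h.1.trans h'.1, h'.2.comp h.2⟩

theorem strongLE_of_strong {S T : L.Substructure A} (hS : K.Strong S) (hT : K.Strong T)
    (h : S ≤ T) : K.StrongLE S T :=
  ⟨h, StrongEmb.of_comp (g := T.subtype) (strongEmb_subtype.2 hS) (strongEmb_subtype.2 hT)⟩

theorem strongLE_top {S : L.Substructure A} : K.StrongLE S ⊤ ↔ K.Strong S := by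
  constructor
  · rintro ⟨h, hs⟩
    exact strongEmb_subtype.1 (hs.equiv_comp topEquiv)
  · intro h
    exact strongLE_of_strong h (K.strong_refl (K.mem_of_strong _ h).2) le_top

/-- The canonical isomorphism of a substructure `S ≤ T`, seen as a substructure of `T`, with `S`. -/
def comapSubtypeEquiv {S T : L.Substructure A} (h : S ≤ T) :
    (S.comap T.subtype.toHom) ≃[L] S where
  toFun x := ⟨x.1.1, x.2⟩
  invFun x := ⟨⟨x.1, h x.2⟩, x.2⟩
  left_inv _ := rfl
  right_inv _ := rfl
  map_fun' _ _ := rfl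
  map_rel' _ _ := Iff.rfl

/-- The relative version of `chain_union`, for chains of substructures of a structure. -/
theorem strongLE_chain_union (δ : Ordinal.{u}) (S : Ordinal.{u} → L.Substructure A)
    (T : L.Substructure A) (hδ : Order.IsSuccLimit δ)
    (hS : ∀ i j, i < j → j < δ → K.StrongLE (S i) (S j))
    (hc : ∀ j, j < δ → Order.IsSuccLimit j → (S j : Set A) = ⋃ i < j, (S i : Set A))
    (hT : (T : Set A) = ⋃ i < δ, (S i : Set A)) : ∀ i < δ, K.StrongLE (S i) T := by
  have hle : ∀ i < δ, S i ≤ T := fun i hi => by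
    rw [← SetLike.coe_subset_coe, hT]
    exact Set.subset_biUnion_of_mem (u := fun i => (S i : Set A)) hi
  have key := K.chain_union (N := T) δ (fun i => (S i).comap T.subtype.toHom) hδ ?_ ?_ ?_
  · exact fun i hi => strongLE_iff.2 ⟨hle i hi, key.2 i hi⟩
  · intro i j hij hj
    have hij' := hS i j hij hj
    have h1 : (S i).comap T.subtype.toHom ≤ (S j).comap T.subtype.toHom :=
      fun x hx => hij'.1 hx
    rw [← strongLE_iff]
    refine ⟨h1, ?_⟩
    exact ((hij'.2.comp_equiv (comapSubtypeEquiv (hle i (hij.trans hj)))).equiv_comp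
      (comapSubtypeEquiv (hle j hj)).symm)
  · intro j hj hjl
    ext x
    have := Set.ext_iff.1 (hc j hj hjl) (x : A)
    simpa using this
  · ext x
    have := Set.ext_iff.1 hT (x : A)
    simpa using this

/-- The relative version of `chain_smooth`, for chains of substructures of a structure. -/
theorem strongLE_chain_smooth (δ : Ordinal.{u}) (S : Ordinal.{u} → L.Substructure A)
    (T R : L.Substructure A) (hδ : Order.IsSuccLimit δ)
    (hS : ∀ i j, i < j → j < δ → K.StrongLE (S i) (S j))
    (hc : ∀ j, j < δ → Order.IsSuccLimit j → (S j : Set A) = ⋃ i < j, (S i : Set A))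
    (hT : (T : Set A) = ⋃ i < δ, (S i : Set A)) (hR : ∀ i < δ, K.StrongLE (S i) R) :
    K.StrongLE T R := by
  have hle : T ≤ R := by
    rw [← SetLike.coe_subset_coe, hT]
    exact Set.iUnion₂_subset fun i hi => (hR i hi).1
  refine strongLE_iff.2 ⟨hle, K.chain_smooth (N := R) δ (fun i => (S i).comap R.subtype.toHom) _ hδ
    ?_ ?_ ?_ fun i hi => (strongLE_iff.1 (hR i hi)).2⟩
  · intro i j hij hj
    have hij' := hS i j hij hj
    rw [← strongLE_iff]
    exact ⟨fun x hx => hij'.1 hx, ((hij'.2.comp_equiv (comapSubtypeEquiv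
      (hR i (hij.trans hj)).1)).equiv_comp (comapSubtypeEquiv (hR j hj).1).symm)⟩
  · intro j hj hjl
    ext x
    have := Set.ext_iff.1 (hc j hj hjl) (x : A)
    simpa using this
  · ext x
    have := Set.ext_iff.1 hT (x : A)
    simpa using this

/-- The inclusion of the ranges is `u` conjugated by the isomorphisms of `A` and `B` with their
images. -/
theorem strongLE_range {u : A ↪[L] B} {f : A ↪[L] C} {g : B ↪[L] C} (h : ∀ x, g (u x) = f x)
    (hu : K.StrongEmb u) : K.StrongLE f.toHom.range g.toHom.range := by
  have hle : f.toHom.range ≤ g.toHom.range := by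
    rintro _ ⟨x, rfl⟩
    exact ⟨u x, h x⟩
  refine ⟨hle, ?_⟩
  convert (hu.equiv_comp g.equivRange).comp_equiv f.equivRange.symm using 1
  ext x
  obtain ⟨x, rfl⟩ := f.equivRange.surjective x
  change f x = g (u (f.equivRange.symm (f.equivRange x)))
  rw [FirstOrder.Language.Equiv.symm_apply_apply, h]

theorem strong_of_nat_chain (S : ℕ → L.Substructure A)
    (hS : ∀ n, K.StrongLE (S n) (S (n + 1))) (hU : ∀ x, ∃ n, x ∈ S n) (n : ℕ) :
    K.Strong (S n) := by
  have hlt : ∀ m n, m < n → K.StrongLE (S m) (S n) := by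
    intro m n h
    induction n, h using Nat.le_induction with
    | base => exact hS m
    | succ n _ ih => exact ih.trans (hS n)
  -- The axiom wants a chain indexed by ordinals; `i.card.toNat` returns `n` at `i = n`, and its
  -- values from `ω` on play no role. Continuity is vacuous, there being no limit below `ω`.
  have key := strongLE_chain_union (K := K) Ordinal.omega0 (fun i => S i.card.toNat) ⊤
    Ordinal.isSuccLimit_omega0 ?_ ?_ ?_ n (Ordinal.natCast_lt_omega0 n)
  · simpa using strongLE_top.1 key
  · intro i j hij hj
    obtain ⟨j, rfl⟩ := Ordinal.lt_omega0.1 hj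
    obtain ⟨i, rfl⟩ := Ordinal.lt_omega0.1 (hij.trans hj)
    simpa using hlt i j (by exact_mod_cast hij)
  · intro j hj hjl
    exact absurd (Ordinal.omega0_le_of_isSuccLimit hjl) (not_le.2 hj)
  · ext x
    obtain ⟨n, hn⟩ := hU x
    simp only [coe_top, Set.mem_univ, Set.mem_iUnion, true_iff]
    exact ⟨n, Ordinal.natCast_lt_omega0 n, by simpa using hn⟩

/-- In a sequence of embeddings with strong two-step compositions, the embeddings are strong:
both the even and the odd members form `≺`-chains with the same direct limit. -/
theorem strongEmb_of_interlaced (G : ℕ → Type u) [∀ n, L.Structure (G n)]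
    (g : ∀ n, G n ↪[L] G (n + 1)) (hg : ∀ n, K.StrongEmb ((g (n + 1)).comp (g n))) :
    K.StrongEmb (g 0) := by
  let D := Language.DirectLimit G (fun m n h => DirectedSystem.natLERec g m n h)
  let e : ∀ n, G n ↪[L] D := fun n =>
    Language.DirectLimit.of L ℕ G (fun m n h => DirectedSystem.natLERec g m n h) n
  have he : ∀ n x, e (n + 1) (g n x) = e n x := by
    intro n x
    rw [← Language.DirectLimit.of_f (f := fun m n h => DirectedSystem.natLERec g m n h)
      (hij := Nat.le_succ n) (x := x)]
    congr 1
    simp [Nat.leRecOn_succ']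
  have hle : ∀ n, (e n).toHom.range ≤ (e (n + 1)).toHom.range := by
    rintro n _ ⟨x, rfl⟩
    exact ⟨g n x, he n x⟩
  have hstep : ∀ n, K.StrongLE (e n).toHom.range (e (n + 2)).toHom.range := by
    intro n
    exact strongLE_range (fun x => ((he (n + 1) _).trans (he n x))) (hg n)
  have hmono : Monotone fun n => (e n).toHom.range := monotone_nat_of_le_succ hle
  -- The members `n, n + 2, n + 4, ...` form a `≺`-chain which, the ranges being increasing, already
  -- exhausts the limit.
  have hstrong : ∀ n, K.StrongEmb (e n) := by
    intro n
    refine strong_of_nat_chain (fun k => (e (n + 2 * k)).toHom.range) (fun k => hstep _) ?_ 0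
    intro x
    obtain ⟨k, y, hy⟩ := Language.DirectLimit.exists_of x
    exact ⟨k, hmono (by omega : k ≤ n + 2 * k) ⟨y, hy⟩⟩
  refine StrongEmb.of_comp (g := e 1) ?_ (hstrong 1)
  have : (e 1).comp (g 0) = e 0 := by ext x; exact he 0 x
  rw [this]
  exact hstrong 0

/-- A family of embeddings `u : A ↪ B` such that each is continued by an embedding `h : B ↪ C` of
the family with `h ∘ u` strong consists of strong embeddings. -/
theorem strongEmb_of_extension {ι : Type*} (G : ι → Type u) [∀ i, L.Structure (G i)]
    (P : ∀ i j, (G i ↪[L] G j) → Prop)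
    (hP : ∀ i j u, P i j u → ∃ k, ∃ h : G j ↪[L] G k, P j k h ∧ K.StrongEmb (h.comp u))
    {i j : ι} {u : G i ↪[L] G j} (hu : P i j u) : K.StrongEmb u := by
  choose k h hh using hP
  -- A state is one embedding of the family. The next state starts at its target, so the sources of
  -- successive states form the interlaced sequence.
  let State := {s : Σ p : ι × ι, (G p.1 ↪[L] G p.2) // P s.1.1 s.1.2 s.2}
  let next : State → State := fun s => ⟨⟨(s.1.1.2, k _ _ _ s.2), h _ _ _ s.2⟩, (hh _ _ _ s.2).1⟩
  let seq : ℕ → State := fun n => Nat.rec ⟨⟨(i, j), u⟩, hu⟩ (fun _ => next) n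
  exact strongEmb_of_interlaced (fun n => G (seq n).1.1.1) (fun n => (seq n).1.2)
    fun n => (hh _ _ _ (seq n).2).2

end StrongEmbeddings
end AbstractElementaryClass

namespace AbstractElementaryClass

open FirstOrder.Language FirstOrder.Language.Substructure

/-! ### Directed unions -/

section DirectedUnions

variable {L : FirstOrder.Language.{u, u}} {K : AbstractElementaryClass L}
  {M : Type u} [L.Structure M]

/-- The union of the substructures indexed by the finite subsets of a set. -/
def finsetUnion {α : Type u} (B : Finset α → L.Substructure M) (A : Set α) : L.Substructure M :=
  ⨆ s : {s : Finset α // (s : Set α) ⊆ A}, B s.1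

theorem mem_finsetUnion {α : Type u} {B : Finset α → L.Substructure M} (hB : Monotone B)
    {A : Set α} {x : M} : x ∈ finsetUnion B A ↔ ∃ s : Finset α, (s : Set α) ⊆ A ∧ x ∈ B s := by
  classical
  have : Nonempty {s : Finset α // (s : Set α) ⊆ A} := ⟨⟨∅, by simp⟩⟩
  rw [finsetUnion, mem_iSup_of_directed]
  · simp
  · rintro ⟨s, hs⟩ ⟨t, ht⟩
    exact ⟨⟨s ∪ t, by simp [hs, ht]⟩, hB Finset.subset_union_left, hB Finset.subset_union_right⟩

theorem exists_bound_of_isSuccLimit {α : Type u} (rk : α → Ordinal.{u}) {δ : Ordinal.{u}}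
    (hδ : Order.IsSuccLimit δ) (s : Finset α) (hs : ∀ a ∈ s, rk a < δ) :
    ∃ i < δ, ∀ a ∈ s, rk a < i := by
  refine ⟨s.sup fun a => Order.succ (rk a), ?_, fun a ha => ?_⟩
  · exact (Finset.sup_lt_iff hδ.bot_lt).2 fun a ha => hδ.succ_lt (hs a ha)
  · exact (Order.lt_succ _).trans_le (Finset.le_sup (f := fun a => Order.succ (rk a)) ha)

/-- Directed unions, by induction on the cardinality of the index set. -/
theorem strongLE_finsetUnion {α : Type u} {B : Finset α → L.Substructure M}
    (hB : ∀ s t, s ⊆ t → K.StrongLE (B s) (B t)) (A : Set α) :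
    (∀ s : Finset α, (s : Set α) ⊆ A → K.StrongLE (B s) (finsetUnion B A)) ∧
      ∀ T, (∀ s : Finset α, (s : Set α) ⊆ A → K.StrongLE (B s) T) →
        K.StrongLE (finsetUnion B A) T := by
  have hmono : Monotone B := fun s t h => (hB s t h).1
  induction hc : #A using WellFoundedLT.induction generalizing A with
  | ind c IH =>
  subst hc
  rcases A.finite_or_infinite with hA | hA
  · obtain ⟨t, rfl⟩ := hA.exists_finset_coe
    have : finsetUnion B (t : Set α) = B t := by
      ext x
      rw [mem_finsetUnion hmono]
      exact ⟨fun ⟨s, hs, hx⟩ => hmono (by exact_mod_cast hs) hx, fun hx => ⟨t, subset_rfl, hx⟩⟩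
    rw [this]
    exact ⟨fun s hs => hB s t (by exact_mod_cast hs), fun T hT => hT t subset_rfl⟩
  have hinf : ℵ₀ ≤ #A := by
    have := hA.to_subtype
    exact aleph0_le_mk A
  have hδ : Order.IsSuccLimit (#A).ord := isSuccLimit_ord hinf
  obtain ⟨e⟩ := Cardinal.eq.1 (mk_ord_toType #A).symm
  classical
  let rk : α → Ordinal.{u} := fun a => if h : a ∈ A then (e ⟨a, h⟩).toOrd.1 else 0
  have hrk : ∀ a (h : a ∈ A), rk a = (e ⟨a, h⟩).toOrd.1 := fun a h => dif_pos h
  have hlt : ∀ a ∈ A, rk a < (#A).ord := fun a h => by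
    rw [hrk a h]
    exact (e ⟨a, h⟩).toOrd.2
  have hinj : ∀ a ∈ A, ∀ b ∈ A, rk a = rk b → a = b := by
    intro a ha b hb hab
    rw [hrk a ha, hrk b hb] at hab
    have := e.injective (Ordinal.ToType.mk.symm.injective (Subtype.ext hab))
    exact congrArg Subtype.val this
  -- Proper initial segments of an enumeration of `A` in order type `#A` have smaller cardinality,
  -- so the induction hypothesis covers them.
  let S : Ordinal.{u} → Set α := fun i => {a | a ∈ A ∧ rk a < i}
  have hcard : ∀ i < (#A).ord, #(S i) < #A := by
    intro i hi
    refine lt_of_le_of_lt ?_ (lt_ord.1 hi)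
    rw [← mk_toType]
    refine mk_le_of_injective (f := fun a : S i => Ordinal.ToType.mk ⟨rk a.1, a.2.2⟩) ?_
    intro a b hab
    have : rk a.1 = rk b.1 :=
      congrArg Subtype.val (Ordinal.ToType.mk.injective hab)
    exact Subtype.ext (hinj _ a.2.1 _ b.2.1 this)
  have IH' : ∀ i < (#A).ord, _ := fun i hi => IH _ (hcard i hi) (S i) rfl
  -- Both halves of the induction hypothesis are needed: the union over `S j` bounds the members
  -- over `S i`, hence lies above their union.
  have hchain : ∀ i j, i < j → j < (#A).ord →
      K.StrongLE (finsetUnion B (S i)) (finsetUnion B (S j)) := fun i j hij hj =>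
    (IH' i (hij.trans hj)).2 _ fun s hs =>
      (IH' j hj).1 s fun a ha => ⟨(hs ha).1, (hs ha).2.trans hij⟩
  -- Continuity holds because a finite subset of a limit segment lies in an earlier one.
  have hunion : ∀ j (C : Set α), Order.IsSuccLimit j → C = {a | a ∈ A ∧ rk a < j} →
      (finsetUnion B C : Set M) = ⋃ i < j, (finsetUnion B (S i) : Set M) := by
    rintro j _ hj rfl
    ext x
    simp only [SetLike.mem_coe, Set.mem_iUnion, mem_finsetUnion hmono]
    constructor
    · rintro ⟨s, hs, hx⟩
      obtain ⟨i, hi, h⟩ := exists_bound_of_isSuccLimit rk hj s fun a ha => (hs ha).2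
      exact ⟨i, hi, s, fun a ha => ⟨(hs ha).1, h a ha⟩, hx⟩
    · rintro ⟨i, hi, s, hs, hx⟩
      exact ⟨s, fun a ha => ⟨(hs ha).1, (hs ha).2.trans hi⟩, hx⟩
  have hcont : ∀ j, j < (#A).ord → Order.IsSuccLimit j →
      (finsetUnion B (S j) : Set M) = ⋃ i < j, (finsetUnion B (S i) : Set M) :=
    fun j _ hjl => hunion j _ hjl rfl
  have htop := hunion _ A hδ (Set.ext fun a => ⟨fun h => ⟨h, hlt a h⟩, fun h => h.1⟩)
  refine ⟨fun s hs => ?_, fun T hT => ?_⟩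
  · obtain ⟨i, hi, h⟩ := exists_bound_of_isSuccLimit rk hδ s fun a ha => hlt a (hs ha)
    exact ((IH' i hi).1 s fun a ha => ⟨hs ha, h a ha⟩).trans
      (strongLE_chain_union (K := K) _ _ _ hδ hchain hcont htop i hi)
  · exact strongLE_chain_smooth _ _ _ _ hδ hchain hcont htop fun i hi =>
      (IH' i hi).2 T fun s hs => hT s fun a ha => (hs ha).1

/-- If `D` is a family of substructures of `T` of size at most `κ` on which inclusion implies `≺`,
and every subset of `T` of size at most `κ` is contained in a member of `D`, then `T` is a `≺`-upper
bound of `D`, and below every other one that contains it. -/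
theorem strongLE_of_cofinal {κ : Cardinal.{u}} (hκ : ℵ₀ ≤ κ) {D : Set (L.Substructure M)}
    {T : L.Substructure M} (hcard : ∀ S ∈ D, #S ≤ κ) (hle : ∀ S ∈ D, S ≤ T)
    (hD : ∀ S ∈ D, ∀ S' ∈ D, S ≤ S' → K.StrongLE S S')
    (hcof : ∀ a : Set M, a ⊆ T → #a ≤ κ → ∃ S ∈ D, a ⊆ S) :
    (∀ S ∈ D, K.StrongLE S T) ∧ ∀ R, (∀ S ∈ D, K.StrongLE S R) → K.StrongLE T R := by
  classical
  have hcof' : ∀ a : Set M, ∃ S : L.Substructure M, a ⊆ T → #a ≤ κ → S ∈ D ∧ a ⊆ S := by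
    intro a
    by_cases h : a ⊆ T ∧ #a ≤ κ
    · obtain ⟨S, hS⟩ := hcof a h.1 h.2
      exact ⟨S, fun _ _ => hS⟩
    · exact ⟨⊤, fun h1 h2 => absurd ⟨h1, h2⟩ h⟩
  choose g hg using hcof'
  have key : ∀ S₀ ∈ D, (K.StrongLE S₀ T) ∧ ∀ R, (∀ S ∈ D, K.StrongLE S R) → K.StrongLE T R := by
    intro S₀ hS₀
    -- The family `D` need not be indexed by finite sets, so a subfamily that is gets chosen: `F s`
    -- is a member of `D` containing `S₀`, the points of `s` and all `F t` for `t ⊂ s`. It is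
    -- monotone with union `T`, and starts above `S₀`.
    let F : Finset T → L.Substructure M := Finset.strongInduction fun s IH =>
      g (S₀ ∪ ((↑) '' (s : Set T) ∪ ⋃ t : {t // t ⊂ s}, (IH t.1 t.2 : Set M)))
    have hF : ∀ s, F s = g (S₀ ∪ ((↑) '' (s : Set T) ∪ ⋃ t : {t // t ⊂ s}, (F t.1 : Set M))) :=
      fun s => Finset.strongInduction_eq _ s
    have hspec : ∀ s : Finset T, F s ∈ D ∧
        ((S₀ : Set M) ∪ ((↑) '' (s : Set T) ∪ ⋃ t : {t // t ⊂ s}, (F t.1 : Set M))) ⊆ F s := by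
      intro s
      induction s using Finset.strongInduction with
      | H s IH =>
      rw [hF s]
      refine hg _ ?_ ?_
      · refine Set.union_subset (hle _ hS₀) (Set.union_subset ?_ (Set.iUnion_subset fun t =>
          hle _ (IH t.1 t.2).1))
        rintro _ ⟨x, _, rfl⟩
        exact x.2
      · refine (mk_union_le _ _).trans (add_le_of_le hκ (hcard _ hS₀) ((mk_union_le _ _).trans
          (add_le_of_le hκ ?_ ?_)))
        · exact (((s.finite_toSet.image _).lt_aleph0).le.trans hκ)
        · have hfin : Finite {t // t ⊂ s} :=
            Finite.of_injective (fun t => (⟨t.1, Finset.mem_powerset.2 t.2.1⟩ : s.powerset))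
              fun a b h => Subtype.ext (by simpa using h)
          refine (mk_iUnion_le_sum_mk).trans ((sum_le_sum _ (fun _ => κ)
            fun t : {t // t ⊂ s} => hcard _ (IH t.1 t.2).1).trans ?_)
          rw [sum_const, lift_id, lift_id]
          exact mul_le_of_le hκ ((lt_aleph0_of_finite _).le.trans hκ) le_rfl
    have hmono : ∀ s t, s ⊆ t → F s ≤ F t := by
      intro s t hst
      rcases hst.eq_or_ssubset with rfl | h
      · exact le_rfl
      · exact fun x hx => (hspec t).2 (Or.inr (Or.inr (Set.mem_iUnion.2 ⟨⟨s, h⟩, hx⟩)))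
    have hB : ∀ s t, s ⊆ t → K.StrongLE (F s) (F t) := fun s t h =>
      hD _ (hspec s).1 _ (hspec t).1 (hmono s t h)
    have hT : finsetUnion F Set.univ = T := by
      ext x
      rw [mem_finsetUnion hmono]
      constructor
      · rintro ⟨s, _, hx⟩
        exact hle _ (hspec s).1 hx
      · intro hx
        exact ⟨{⟨x, hx⟩}, Set.subset_univ _, (hspec _).2 (Or.inr (Or.inl ⟨⟨x, hx⟩, by simp⟩))⟩
    have hu := strongLE_finsetUnion hB Set.univ
    rw [hT] at hu
    refine ⟨?_, fun R hR => hu.2 R fun s _ => hR _ (hspec s).1⟩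
    exact (hD _ hS₀ _ (hspec ∅).1 fun x hx => (hspec ∅).2 (Or.inl hx)).trans
      (hu.1 ∅ (Set.subset_univ _))
  refine ⟨fun S hS => (key S hS).1, ?_⟩
  obtain ⟨S₀, hS₀, -⟩ := hcof ∅ (Set.empty_subset _) (by simp)
  exact (key S₀ hS₀).2

end DirectedUnions
end AbstractElementaryClass

/-! ### Atomic formulas under renaming and embeddings -/

section AtomicFormulas

variable {L : FirstOrder.Language.{u, u}} {V W M N : Type u} [L.Structure M] [L.Structure N]

theorem AtomicFormula.realize_relabel (a : AtomicFormula L V) (g : V → W) (v : W → M) :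
    (a.relabel g).Realize v ↔ a.Realize (v ∘ g) := by
  cases a <;> simp [AtomicFormula.relabel, AtomicFormula.Realize]

theorem AtomicFormula.realize_embedding (a : AtomicFormula L V) (g : M ↪[L] N) (v : V → M) :
    a.Realize (fun x => g (v x)) ↔ a.Realize v := by
  have ht : ∀ t : L.Term V, t.realize (fun x => g (v x)) = g (t.realize v) :=
    fun t => FirstOrder.Language.HomClass.realize_term g
  cases a with
  | eq t s => simp only [AtomicFormula.Realize, ht, g.injective.eq_iff]
  | rel R ts =>
    simp only [AtomicFormula.Realize, ht]
    exact g.map_rel R fun i => (ts i).realize v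

end AtomicFormulas

namespace AbstractElementaryClass

open FirstOrder.Language FirstOrder.Language.Substructure

/-! ### The relations defined by the formulas -/

section Semantics

variable {L : FirstOrder.Language.{u, u}} {K : AbstractElementaryClass L}
  {M : Type u} [L.Structure M]

/-- The relation that `φ_{N,γ,n}` defines on maps `f` of the universe of `N` into `M`. -/
noncomputable def Sem (M : Type u) [L.Structure M] (γ : Ordinal.{u}) :
    ∀ n : ℕ, K.Node n → (K.Univ n → M) → Prop :=
  Ordinal.limitRecOn (motive := fun _ => ∀ n : ℕ, K.Node n → (K.Univ n → M) → Prop) γ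
    (fun _ N f => ∀ a : AtomicFormula L _, a.Realize N.elt ↔ a.Realize f)
    (fun _ IH n N f => ∀ z : K.Idx → M, ∃ N' : K.Node (n + 1), N.StrongSub N' ∧
      ∃ f' : K.Univ (n + 1) → M, (∀ p : K.Univ n, f' ⟨p.1, p.2.trans (Nat.lt_succ_self n)⟩ = f p) ∧
        IH (n + 1) N' f' ∧ ∀ ζ, ∃ p, z ζ = f' p)
    (fun γ _ IH n N f => ∀ β, ∀ h : β < γ, IH β h n N f)

theorem sem_zero {n : ℕ} {N : K.Node n} {f : K.Univ n → M} :
    Sem M 0 n N f ↔ ∀ a : AtomicFormula L (K.Univ n), a.Realize N.elt ↔ a.Realize f := by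
  rw [Sem, Ordinal.limitRecOn_zero]

theorem sem_add_one {β : Ordinal.{u}} {n : ℕ} {N : K.Node n} {f : K.Univ n → M} :
    Sem M (β + 1) n N f ↔ ∀ z : K.Idx → M, ∃ N' : K.Node (n + 1), N.StrongSub N' ∧
      ∃ f' : K.Univ (n + 1) → M, (∀ p : K.Univ n, f' ⟨p.1, p.2.trans (Nat.lt_succ_self n)⟩ = f p) ∧
        Sem M β (n + 1) N' f' ∧ ∀ ζ, ∃ p, z ζ = f' p := by
  rw [Sem, Ordinal.limitRecOn_add_one]
  rfl

theorem sem_limit {γ : Ordinal.{u}} (hγ : Order.IsSuccLimit γ) {n : ℕ} {N : K.Node n}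
    {f : K.Univ n → M} : Sem M γ n N f ↔ ∀ β < γ, Sem M β n N f := by
  rw [Sem, Ordinal.limitRecOn_limit _ _ _ _ hγ]
  rfl

/-- This removes variables and assignments from the rest of the argument. The quantified blocks `z̄`
and `x̄_{=n}` are disjoint from each other and from the free variables, so their values can be
overwritten independently. -/
theorem realize_phi_iff (γ : Ordinal.{u}) {n : ℕ} {N : K.Node n} {v : K.Var → M} :
    (phi γ n N).Realize v ↔ Sem M γ n N (fun p => v (Var.x p.1)) := by
  induction γ using Ordinal.limitRecOn generalizing n v with
  | zero =>
    rw [phi, Ordinal.limitRecOn_zero, sem_zero]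
    refine forall_congr' fun a => ?_
    by_cases h : a.Realize N.elt
    · simp only [h, if_true, true_iff, InfFormula.Realize, AtomicFormula.realize_relabel]
      rfl
    · simp only [h, if_false, false_iff, InfFormula.Realize, AtomicFormula.realize_relabel]
      rfl
  | add_one β IH =>
    rw [phi, Ordinal.limitRecOn_add_one, sem_add_one]
    constructor
    · intro h z
      let w : K.Var → M := fun y => match y with
        | Var.x p => v (Var.x p)
        | Var.z ζ => z ζ
      obtain ⟨⟨N', hN'⟩, w', hw', h1, h2⟩ := h w (by
        rintro (p | ζ) hx
        · rfl
        · exact absurd ⟨ζ, rfl⟩ hx)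
      refine ⟨N', hN', fun p => w' (Var.x p.1), ?_, IH.1 h1, ?_⟩
      · intro p
        refine hw' _ ?_
        rintro ⟨ζ, hζ⟩
        have hp : (n, ζ) = p.1 := by simpa using hζ
        exact absurd (congrArg Prod.fst hp) p.2.ne'
      · intro ζ
        obtain ⟨p, hp⟩ := h2 ζ
        refine ⟨p, ?_⟩
        have hz : w' (Var.z ζ) = z ζ := hw' _ (by rintro ⟨_, h⟩; cases h)
        rw [← hz]
        exact hp
    · intro h w hw
      obtain ⟨N', hN', f', hf', h1, h2⟩ := h fun ζ => w (Var.z ζ)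
      -- Overwriting all of the first `n + 1` blocks by `f'` changes only block `n`, since `f'`
      -- extends the given values on the earlier blocks.
      let w' : K.Var → M := fun y => match y with
        | Var.x p => if hp : p.1 < n + 1 then f' ⟨p, hp⟩ else w (Var.x p)
        | Var.z ζ => w (Var.z ζ)
      have hw'x : ∀ p : K.Univ (n + 1), w' (Var.x p.1) = f' p := fun p => dif_pos p.2
      refine ⟨⟨N', hN'⟩, w', ?_, ?_, ?_⟩
      · rintro (p | ζ) hx
        · by_cases hp : p.1 < n + 1
          · have hpn : p.1 < n := by
              refine lt_of_le_of_ne (Nat.le_of_lt_succ hp) ?_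
              rintro rfl
              exact hx ⟨p.2, rfl⟩
            rw [hw'x ⟨p, hp⟩, hf' ⟨p, hpn⟩]
            exact (hw _ (by rintro ⟨_, h⟩; cases h)).symm
          · exact dif_neg hp
        · rfl
      · refine IH.2 ?_
        simp only [hw'x]
        exact h1
      · intro ζ
        obtain ⟨p, hp⟩ := h2 ζ
        exact ⟨p, hp.trans (hw'x p).symm⟩
  | limit γ hl IH =>
    rw [phi, Ordinal.limitRecOn_limit _ _ _ _ hl, sem_limit hl]
    constructor
    · intro h β hβ
      have := h (Ordinal.ToType.mk ⟨β, hβ⟩)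
      simp only [Ordinal.ToType.toOrd, OrderIso.symm_apply_apply] at this
      exact (IH β hβ).1 this
    · exact fun h β => (IH _ β.toOrd.2).2 (h _ β.toOrd.2)

/-- Only the values at the free variables matter; nonemptiness supplies values for the other
variables, so that some assignment exists. -/
theorem satPhi_iff [Nonempty M] {γ : Ordinal.{u}} {n : ℕ} {N : K.Node n} {f : N → M} :
    SatPhi N γ f ↔ Sem M γ n N (fun p => f (N.elt p)) := by
  constructor
  · intro h
    let v : K.Var → M := fun y => match y with
      | Var.x p => if hp : p.1 < n then f (N.elt ⟨p, hp⟩) else Classical.arbitrary M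
      | Var.z _ => Classical.arbitrary M
    have hv : ∀ p : K.Univ n, v (Var.x p.1) = f (N.elt p) := fun p => dif_pos p.2
    have := (realize_phi_iff γ).1 (h v hv)
    simpa only [hv] using this
  · intro h v hv
    rw [realize_phi_iff]
    simpa only [hv] using h

theorem sem_zero_of_embedding {n : ℕ} {N : K.Node n} (g : N ↪[L] M) :
    Sem M 0 n N (fun p => g (N.elt p)) :=
  sem_zero.2 fun a => (a.realize_embedding g N.elt).symm

/-- The diagram contains the equations `x = y` (injectivity), the equations `F x̄ = y` (functions)
and the atoms `R x̄` (relations). -/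
theorem exists_embedding_of_sem_zero {n : ℕ} {N : K.Node n} {f : K.Univ n → M}
    (h : Sem M 0 n N f) : ∃ g : N ↪[L] M, ∀ p, g (N.elt p) = f p := by
  rw [sem_zero] at h
  refine ⟨⟨⟨f, ?_⟩, ?_, ?_⟩, fun _ => rfl⟩
  · intro x y hxy
    exact (h (.eq (.var x) (.var y))).2 hxy
  · intro k F x
    exact ((h (.eq (.func F fun i => .var (x i))
      (.var (Structure.funMap F x : N)))).1 rfl).symm
  · intro k R x
    exact (h (.rel R fun i => .var (x i))).symm

theorem Sem.mono [Nonempty M] {β γ : Ordinal.{u}} (hβγ : β ≤ γ) {n : ℕ} {N : K.Node n}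
    {f : K.Univ n → M} (h : Sem M γ n N f) : Sem M β n N f := by
  -- Descent to rank `0` needs its own argument: a successor formula speaks about `N` only through
  -- an extension `N'`, and the diagram of `N'` restricts to that of `N`.
  have hzero : ∀ (γ : Ordinal.{u}) {n : ℕ} {N : K.Node n} {f : K.Univ n → M},
      Sem M γ n N f → Sem M 0 n N f := by
    intro γ
    induction γ using Ordinal.limitRecOn with
    | zero => exact id
    | add_one γ IH =>
      intro n N f h
      obtain ⟨N', ⟨_, i, hi, -⟩, f', hf', h1, -⟩ := sem_add_one.1 h fun _ => Classical.arbitrary M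
      obtain ⟨g, hg⟩ := exists_embedding_of_sem_zero (IH h1)
      convert sem_zero_of_embedding (g.comp i) using 2 with p
      rw [← hf', ← hg, Embedding.comp_apply, hi]
    | limit γ hl IH => exact fun h => sem_limit hl |>.1 h 0 hl.bot_lt
  induction β using Ordinal.limitRecOn generalizing γ n with
  | zero => exact hzero γ h
  | add_one β IH =>
    induction γ using Ordinal.limitRecOn with
    | zero => exact absurd hβγ (by simp)
    | add_one γ =>
      rw [sem_add_one] at h ⊢
      intro z
      obtain ⟨N', hN', f', hf', h1, h2⟩ := h z
      exact ⟨N', hN', f', hf', IH (by simpa using hβγ) h1, h2⟩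
    | limit γ hl IH' =>
      refine sem_limit hl |>.1 h _ (lt_of_le_of_ne hβγ ?_)
      rintro rfl
      exact hl.succ_ne _ (Order.succ_eq_add_one β)
  | limit β hl IH => exact sem_limit hl |>.2 fun α hα => IH α hα (hα.le.trans hβγ) h

end Semantics

/-! ### The pigeonhole argument: inclusion implies `≺` -/

section Pigeonhole

variable {L : FirstOrder.Language.{u, u}} (K : AbstractElementaryClass L)
  {M : Type u} [L.Structure M]

theorem exists_surjective_idx {m : ℕ} (hm : 0 < m) : ∃ z : K.Idx → K.Univ m, Function.Surjective z := by
  have hne : Nonempty K.Idx := by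
    rw [← mk_ne_zero_iff, mk_ord_toType]
    exact (aleph0_pos.trans_le K.lst_spec.1).ne'
  have : Nonempty (K.Univ m) := ⟨⟨(0, Classical.arbitrary _), hm⟩⟩
  obtain ⟨e⟩ : Nonempty (K.Univ m ↪ K.Idx) := by
    rw [← Cardinal.le_def, mk_ord_toType]
    exact K.mk_univ_le m
  exact ⟨Function.invFun e, Function.invFun_surjective e.injective⟩

/-- There are at most `2 ^ κ` nodes, and at most `κ ^ κ = 2 ^ κ` maps into each. -/
theorem mk_extension_le {n m : ℕ} (N' : K.Node m) :
    #(Σ N : K.Node n, (N' ↪[L] N)) ≤ 2 ^ K.lst := by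
  have hinf : ℵ₀ ≤ (2 : Cardinal) ^ K.lst := K.lst_spec.1.trans (cantor _).le
  rw [mk_sigma]
  refine (sum_le_sum _ (fun _ => 2 ^ K.lst) fun N => ?_).trans ?_
  · refine (mk_le_of_injective (f := fun g : N' ↪[L] N => (g : N' → N))
      DFunLike.coe_injective).trans ?_
    calc #(N' → N) = #(K.Univ n) ^ #(K.Univ m) := (power_def _ _).symm
      _ ≤ K.lst ^ #(K.Univ m) := power_le_power_right (K.mk_univ_le n)
      _ ≤ K.lst ^ K.lst :=
        power_le_power_left (aleph0_pos.trans_le K.lst_spec.1).ne' (K.mk_univ_le m)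
      _ = 2 ^ K.lst := power_self_eq K.lst_spec.1
  · rw [sum_const, lift_id, lift_id]
    exact mul_le_of_le hinf (K.mk_node_le n) le_rfl

/-- If every `c` failed at some rank below `μ`, the supremum of these fewer than `μ` ranks would be
below `μ`, and no `c` could work there. -/
theorem exists_forall_of_regular {C : Type u} {μ : Cardinal.{u}} (hμ : μ.IsRegular) (hC : #C < μ)
    {R : Ordinal.{u} → C → Prop} (hR : ∀ β γ c, β ≤ γ → R γ c → R β c)
    (h : ∀ γ < μ.ord, ∃ c, R γ c) : ∃ c, ∀ γ < μ.ord, R γ c := by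
  by_contra! hno
  choose b hb hb' using hno
  obtain ⟨c, hc⟩ := h _ (Ordinal.iSup_lt_of_lt_cof (by rwa [hμ.cof_ord]) hb)
  exact hb' c (hR _ _ _ (Ordinal.le_iSup b c) hc)

theorem exists_factor {A B C : Type u} [L.Structure A] [L.Structure B] [L.Structure C]
    (f : A ↪[L] C) (g : B ↪[L] C) (h : Set.range f ⊆ Set.range g) :
    ∃ u : A ↪[L] B, ∀ x, g (u x) = f x := by
  have hle : f.toHom.range ≤ g.toHom.range := fun x hx => h hx
  refine ⟨g.equivRange.symm.toEmbedding.comp ((inclusion hle).comp f.equivRange.toEmbedding),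
    fun x => ?_⟩
  change ((g.equivRange (g.equivRange.symm (inclusion hle (f.equivRange x))) :
    g.toHom.range) : C) = f x
  rw [FirstOrder.Language.Equiv.apply_symm_apply]
  rfl

variable {K}

/-- If `N ⊆ N'` are submodels of `M` that satisfy their formulas of rank `(2 ^ κ)⁺` in `M`, then
`N ≺ N'`. -/
theorem strongLE_of_sem {n m : ℕ} (hm : 0 < m) {N : K.Node n} {N' : K.Node m} (f : N ↪[L] M)
    (f' : N' ↪[L] M) (hff' : Set.range f ⊆ Set.range f')
    (hf : Sem M (Order.succ ((2 : Cardinal.{u}) ^ K.lst)).ord n N fun p => f (N.elt p))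
    (hf' : Sem M (Order.succ ((2 : Cardinal.{u}) ^ K.lst)).ord m N' fun p => f' (N'.elt p)) :
    K.StrongLE f.toHom.range f'.toHom.range := by
  obtain ⟨z₀, -⟩ := K.exists_surjective_idx hm
  have hinf : ℵ₀ ≤ (2 : Cardinal) ^ K.lst := K.lst_spec.1.trans (cantor _).le
  have hreg := isRegular_succ hinf
  have hμl := isSuccLimit_ord hreg.aleph0_le
  have hne : Nonempty M := by
    have : Nonempty K.Idx := by
      rw [← mk_ne_zero_iff, mk_ord_toType]
      exact (aleph0_pos.trans_le K.lst_spec.1).ne'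
    exact ⟨f' (N'.elt (z₀ (Classical.arbitrary _)))⟩
  obtain ⟨u, hu⟩ := exists_factor f f' hff'
  -- The family fixes only the abstract inclusion `u`; its copies in `M` may change with `γ`. The
  -- sequence built from it therefore need not live in `M`, which is why a direct limit is used.
  refine strongLE_range hu (strongEmb_of_extension (ι := Σ n, K.Node n) (fun i => i.2)
    (fun i j u => 0 < j.1 ∧ ∀ γ < (Order.succ ((2 : Cardinal.{u}) ^ K.lst)).ord,
      ∃ (f : i.2 ↪[L] M) (f' : j.2 ↪[L] M), (∀ x, f' (u x) = f x) ∧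
        Sem M γ i.1 i.2 (fun p => f (i.2.elt p)) ∧ Sem M γ j.1 j.2 fun p => f' (j.2.elt p))
    ?_ (i := ⟨n, N⟩) (j := ⟨m, N'⟩)
    ⟨hm, fun γ hγ => ⟨f, f', hu, hf.mono hγ.le, hf'.mono hγ.le⟩⟩)
  rintro ⟨n, N⟩ ⟨m, N'⟩ u ⟨hm, h⟩
  dsimp only at u hm h ⊢
  have key := exists_forall_of_regular hreg
    (C := Σ N₂ : K.Node (n + 1), (N' ↪[L] N₂))
    (R := fun γ c => (∃ (f' : N' ↪[L] M) (f₂ : c.1 ↪[L] M), (∀ x, f₂ (c.2 x) = f' x) ∧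
      Sem M γ m N' (fun p => f' (N'.elt p)) ∧ Sem M γ (n + 1) c.1 fun p => f₂ (c.1.elt p)) ∧
        K.StrongEmb (c.2.comp u))
    (Order.lt_succ_of_le (K.mk_extension_le N'))
    (fun β γ c hβγ ⟨⟨f', f₂, h1, h2, h3⟩, h4⟩ =>
      ⟨⟨f', f₂, h1, h2.mono hβγ, h3.mono hβγ⟩, h4⟩) ?_
  · obtain ⟨⟨N₂, g⟩, hc⟩ := key
    exact ⟨⟨n + 1, N₂⟩, g, ⟨n.succ_pos, fun γ hγ => (hc γ hγ).1⟩, (hc 0 hμl.bot_lt).2⟩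
  · intro γ hγ
    -- One rank is spent on extending `N`, with `z` listing the whole copy of `N'`. The extension
    -- has level `n + 1` whatever the level of `N'`, so `g` need not be an inclusion along the tree.
    obtain ⟨f, f', hff', hf, hf'⟩ := h (γ + 1) (hμl.add_one_lt hγ)
    obtain ⟨z, hz⟩ := K.exists_surjective_idx hm
    obtain ⟨N₂, ⟨_, i, hi, his⟩, k, hk, h1, h2⟩ := sem_add_one.1 hf fun ζ => f' (N'.elt (z ζ))
    obtain ⟨f₂, hf₂⟩ := exists_embedding_of_sem_zero (h1.mono (zero_le))
    obtain ⟨g, hg⟩ := exists_factor f' f₂ (by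
      rintro _ ⟨y, rfl⟩
      obtain ⟨ζ, hζ⟩ := hz y
      obtain ⟨p, hp⟩ := h2 ζ
      exact ⟨N₂.elt p, (hf₂ p).trans (hp.symm.trans (by rw [hζ]; rfl))⟩)
    refine ⟨⟨N₂, g⟩, ⟨f', f₂, hg, hf'.mono (Order.le_succ γ), ?_⟩, ?_⟩
    · simpa only [hf₂] using h1
    -- Both maps become `f` after composition with the injective `f₂`; and `i`, the inclusion of `N`
    -- in `N₂` along the tree, is strong.
    · have : g.comp u = i := by
        ext x
        refine f₂.injective ?_
        rw [Embedding.comp_apply, hg, hff']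
        exact ((hf₂ _).trans (hk x)).symm.trans (congrArg f₂ (hi x).symm)
      dsimp only
      rw [this]
      exact his

end Pigeonhole
end AbstractElementaryClass

namespace AbstractElementaryClass

open FirstOrder.Language FirstOrder.Language.Substructure

/-! ### Nodes of the canonical tree inside a model -/

section CanonicalTree

variable {L : FirstOrder.Language.{u, u}} {K : AbstractElementaryClass L}
  {M : Type u} [L.Structure M]

/-- Transport of a `≺`-submodel to a node of the canonical tree along a bijection. -/
theorem exists_node {n : ℕ} {S : L.Substructure M} (hS : K.Strong S) (e : K.Univ n ≃ S)
    (hP : ∀ m, 0 < m → m < n → ∃ P : L.Substructure M,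
      (∀ p : K.Univ n, (e p : M) ∈ P ↔ p.1.1 < m) ∧ P ≤ S ∧ K.Strong P) :
    ∃ (N : K.Node n) (f : N ↪[L] M), K.StrongEmb f ∧ ∀ p, f (N.elt p) = e p := by
  let str : L.Structure (K.Univ n) := e.symm.inducedStructure
  let ε : S ≃[L] K.Univ n := e.symm.inducedStructureEquiv
  refine ⟨⟨str, K.mem_iso ε (K.mem_of_strong _ hS).1, fun m h0 hm => ?_⟩,
    S.subtype.comp ε.symm.toEmbedding, (strongEmb_subtype.2 hS).comp_equiv ε.symm, fun p => rfl⟩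
  obtain ⟨P, hPm, hPS, hPs⟩ := hP m h0 hm
  refine ⟨(ε.toEmbedding.comp (inclusion hPS)).toHom.range, ?_,
    (strongLE_of_strong hPs hS hPS).2.equiv_comp ε⟩
  ext p
  rw [Set.mem_ofPred_eq, ← hPm]
  constructor
  · rintro ⟨x, rfl⟩
    have : (e (e.symm (inclusion hPS x)) : M) ∈ P := by
      rw [e.apply_symm_apply]
      exact x.2
    exact this
  · intro h
    exact ⟨⟨e p, h⟩, e.symm_apply_apply p⟩

theorem exists_node_one {S : L.Substructure M} (hS : K.Strong S) (hcard : #S = K.lst) :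
    ∃ (N : K.Node 1) (f : N ↪[L] M), K.StrongEmb f ∧ Set.range f = S := by
  obtain ⟨e₁⟩ : Nonempty (K.Idx ≃ S) := by rw [← Cardinal.eq, mk_ord_toType, hcard]
  let e₀ : K.Univ 1 ≃ K.Idx :=
    { toFun := fun p => p.1.2
      invFun := fun ζ => ⟨(0, ζ), one_pos⟩
      left_inv := fun p => Subtype.ext (Prod.ext (Nat.lt_one_iff.1 p.2).symm rfl)
      right_inv := fun _ => rfl }
  obtain ⟨N, f, hf, hfe⟩ := exists_node hS (e₀.trans e₁) (fun m h0 h1 => by omega)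
  refine ⟨N, f, hf, Set.ext fun x => ⟨?_, fun hx => ?_⟩⟩
  · rintro ⟨p, rfl⟩
    have : f p = (e₀.trans e₁) p := hfe p
    rw [this]
    exact Subtype.mem _
  · exact ⟨N.elt ((e₀.trans e₁).symm ⟨x, hx⟩), by rw [hfe, Equiv.apply_symm_apply]⟩

theorem mk_range_node_le {n : ℕ} {N : K.Node n} {X : Type u} (f : N → X) : #(Set.range f) ≤ K.lst :=
  mk_range_le.trans (K.mk_univ_le n)

/-- A Löwenheim-Skolem submodel over the image of `N` and `A` might add fewer than `κ` points, too
few to fill a block. Hence `κ` points `Y` outside the image are thrown in; they exist because `M`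
has more than `κ` elements. -/
theorem exists_node_extension (hM : K.lst < #M) {n : ℕ} {N : K.Node n} {f : N ↪[L] M}
    (hf : K.StrongEmb f) (A : Set M) (hA : #A ≤ K.lst) :
    ∃ N' : K.Node (n + 1), N.StrongSub N' ∧ ∃ f' : N' ↪[L] M, K.StrongEmb f' ∧
      (∀ p : K.Univ n, f' (N'.elt ⟨p.1, p.2.trans (Nat.lt_succ_self n)⟩) = f (N.elt p)) ∧
      A ⊆ Set.range f' := by
  have hinf := K.lst_spec.1
  have hMi : Infinite M := infinite_iff.2 (hinf.trans hM.le)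
  have hR := mk_range_node_le (K := K) (N := N) f
  obtain ⟨Y, hYR, hY⟩ := le_mk_iff_exists_subset.1
    (hM.le.trans (mk_compl_of_infinite _ (hR.trans_lt hM)).ge)
  obtain ⟨S, hS, hAS, hScard⟩ := K.lst_spec.2.2 hf.mem_cod (Set.range f ∪ (A ∪ Y))
  have hScard' : #S ≤ K.lst := hScard.trans (add_le_of_le hinf ((mk_union_le _ _).trans
    (add_le_of_le hinf hR ((mk_union_le _ _).trans (add_le_of_le hinf hA hY.le)))) le_rfl)
  have hfS : ∀ y, f y ∈ S := fun y => hAS (Or.inl ⟨y, rfl⟩)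
  obtain ⟨ε⟩ : Nonempty (K.Idx ≃ ((S : Set M) \ Set.range f : Set M)) := by
    rw [← Cardinal.eq, mk_ord_toType]
    refine le_antisymm (hY.ge.trans (mk_le_mk_of_subset ?_))
      ((mk_le_mk_of_subset Set.sdiff_subset).trans hScard')
    exact fun x hx => ⟨hAS (Or.inr (Or.inr hx)), hYR hx⟩
  -- The old blocks are placed by `f`, and the new one by an enumeration of the rest of `S`.
  let F : K.Univ (n + 1) → S := fun p =>
    if h : p.1.1 < n then ⟨f (N.elt ⟨p.1, h⟩), hfS _⟩ else ⟨ε p.1.2, (ε p.1.2).2.1⟩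
  have hF1 : ∀ (p : K.Univ (n + 1)) (h : p.1.1 < n), (F p : M) = f (N.elt ⟨p.1, h⟩) :=
    fun p h => by simp only [F, dif_pos h]
  have hF2 : ∀ (p : K.Univ (n + 1)), ¬ p.1.1 < n → (F p : M) = ε p.1.2 :=
    fun p h => by simp only [F, dif_neg h]
  have hFinj : Function.Injective F := by
    intro p q hpq
    have hpq' : (F p : M) = F q := congrArg Subtype.val hpq
    by_cases hp : p.1.1 < n <;> by_cases hq : q.1.1 < n
    · rw [hF1 p hp, hF1 q hq] at hpq'
      have := congrArg Subtype.val (f.injective hpq' : (⟨p.1, hp⟩ : K.Univ n) = ⟨q.1, hq⟩)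
      exact Subtype.ext this
    · rw [hF1 p hp, hF2 q hq] at hpq'
      exact absurd ⟨_, hpq'⟩ (ε q.1.2).2.2
    · rw [hF2 p hp, hF1 q hq] at hpq'
      exact absurd ⟨_, hpq'.symm⟩ (ε p.1.2).2.2
    · rw [hF2 p hp, hF2 q hq] at hpq'
      have h1 := p.2
      have h2 := q.2
      exact Subtype.ext (Prod.ext (by omega) (ε.injective (Subtype.ext hpq')))
  have hFsurj : Function.Surjective F := by
    rintro ⟨x, hx⟩
    by_cases h : x ∈ Set.range f
    · obtain ⟨y, rfl⟩ := h
      let p : K.Univ n := y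
      exact ⟨⟨p.1, p.2.trans (Nat.lt_succ_self n)⟩, Subtype.ext (hF1 _ p.2)⟩
    · refine ⟨⟨(n, ε.symm ⟨x, hx, h⟩), Nat.lt_succ_self n⟩, Subtype.ext ?_⟩
      rw [hF2 _ (lt_irrefl n)]
      simp
  obtain ⟨N', f', hf', hfe⟩ := exists_node hS (Equiv.ofBijective F ⟨hFinj, hFsurj⟩) (by
    intro m h0 hm
    -- The initial segment of length `n` is the image of `N` itself; the shorter ones are images of
    -- those of `N`, strong by transitivity.
    rcases (Nat.le_of_lt_succ hm).eq_or_lt with rfl | hmn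
    · refine ⟨f.toHom.range, fun p => ?_, ?_, hf⟩
      · by_cases hp : p.1.1 < m
        · exact iff_of_true ⟨_, (hF1 p hp).symm⟩ hp
        · refine iff_of_false (fun h => ?_) hp
          have h' : (F p : M) ∈ Set.range f := h
          rw [hF2 p hp] at h'
          exact (ε p.1.2).2.2 h'
      · rintro _ ⟨y, rfl⟩
        exact hfS y
    · obtain ⟨P, hP, hPs⟩ := N.strong m h0 hmn
      have hP' : ∀ y : K.Univ n, y ∈ P ↔ y.1.1 < m := fun y => Set.ext_iff.1 hP y
      let P₁ : L.Substructure N := P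
      refine ⟨(f.comp P₁.subtype).toHom.range, fun p => ?_, ?_,
        hf.comp (f := P₁.subtype) (strongEmb_subtype.2 hPs)⟩
      · constructor
        · rintro ⟨y, hy⟩
          have hy' : f y.1 = F p := hy
          by_cases hp : p.1.1 < n
          · rw [hF1 p hp] at hy'
            have h1 : y.1 = N.elt ⟨p.1, hp⟩ := f.injective hy'
            have h2 : N.elt ⟨p.1, hp⟩ ∈ P₁ := by
              rw [← h1]
              exact y.2
            exact (hP' ⟨p.1, hp⟩).1 h2
          · rw [hF2 p hp] at hy'
            exact absurd ⟨_, hy'⟩ (ε p.1.2).2.2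
        · intro hp
          exact ⟨⟨N.elt ⟨p.1, hp.trans hmn⟩, (hP' ⟨p.1, hp.trans hmn⟩).2 hp⟩,
            (hF1 p (hp.trans hmn)).symm⟩
      · rintro _ ⟨y, rfl⟩
        exact hfS y.1)
  have hfe' : ∀ p : K.Univ n,
      f' (N'.elt ⟨p.1, p.2.trans (Nat.lt_succ_self n)⟩) = f (N.elt p) :=
    fun p => (hfe _).trans (hF1 _ p.2)
  obtain ⟨g, hg⟩ := exists_factor f f' (by
    rintro _ ⟨y, rfl⟩
    exact ⟨_, hfe' y⟩)
  have hfg : f'.comp g = f := by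
    ext x
    exact hg x
  refine ⟨N', ⟨n.le_succ, g, fun p => f'.injective ((hg _).trans (hfe' p).symm),
    StrongEmb.of_comp (g := f') (by rwa [hfg]) hf'⟩, f', hf', hfe', fun x hx => ?_⟩
  obtain ⟨p, hp⟩ := hFsurj ⟨x, hAS (Or.inr (Or.inl hx))⟩
  exact ⟨N'.elt p, (hfe p).trans (congrArg Subtype.val hp)⟩

/-- A strong embedding always extends to a strong embedding of a next node that covers `z`, so the
induction on the rank never gets stuck. -/
theorem sem_of_strongEmb (hM : K.lst < #M) (γ : Ordinal.{u}) {n : ℕ} {N : K.Node n}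
    {f : N ↪[L] M} (hf : K.StrongEmb f) : Sem M γ n N fun p => f (N.elt p) := by
  induction γ using Ordinal.limitRecOn generalizing n with
  | zero => exact sem_zero_of_embedding f
  | add_one β IH =>
    refine sem_add_one.2 fun z => ?_
    obtain ⟨N', hN', f', hf', h1, h2⟩ := exists_node_extension hM hf (Set.range z)
      (mk_range_le.trans (by simp))
    exact ⟨N', hN', _, h1, IH hf', fun ζ => (h2 ⟨ζ, rfl⟩).imp fun _ h => h.symm⟩
  | limit γ hl IH => exact (sem_limit hl).2 fun β hβ => IH β hβ hf

end CanonicalTree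

/-! ### The conditions (B) and (C) -/

section Conditions

variable {L : FirstOrder.Language.{u, u}} {K : AbstractElementaryClass L}
  {M : Type u} [L.Structure M]

theorem mk_rang_le {κ : Cardinal.{u}} {X : Type u} (a : ShortSeq κ X) : #a.rang ≤ κ := by
  refine mk_range_le.trans ?_
  rw [mk_toType]
  simpa using Ordinal.card_le_card a.len_le

theorem exists_rang_eq {κ : Cardinal.{u}} {X : Type u} (A : Set X) (hA : #A ≤ κ) :
    ∃ a : ShortSeq κ X, a.rang = A := by
  obtain ⟨e⟩ := Cardinal.eq.1 (mk_ord_toType #A)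
  exact ⟨⟨(#A).ord, ord_le_ord.2 hA, fun i => e i⟩,
    (e.surjective.range_comp _).trans Subtype.range_coe⟩

theorem exists_subset_range {κ : Cardinal.{u}} {X : Type u} [Nonempty X] (A : Set X)
    (hA : #A ≤ κ) : ∃ z : κ.ord.ToType → X, A ⊆ Set.range z := by
  classical
  obtain ⟨e⟩ : Nonempty (A ↪ κ.ord.ToType) := by rwa [← Cardinal.le_def, mk_ord_toType]
  refine ⟨Function.extend e Subtype.val fun _ => Classical.arbitrary X, fun x hx =>
    ⟨e ⟨x, hx⟩, e.injective.extend_apply _ _ _⟩⟩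

theorem succ_lt_lam : Order.succ ((2 : Cardinal.{u}) ^ K.lst) < K.lam :=
  (Order.succ_le_of_lt (cantor _)).trans_lt ((Order.lt_succ _).trans (Order.lt_succ _))

/-- The submodels of `M` that are images of nodes of the canonical tree and satisfy the
corresponding formula of rank `(2 ^ κ)⁺`. -/
def semSubmodels (K : AbstractElementaryClass L) (M : Type u) [L.Structure M] :
    Set (L.Substructure M) :=
  {S | ∃ n, 0 < n ∧ ∃ (N : K.Node n) (f : N ↪[L] M), f.toHom.range = S ∧
    Sem M (Order.succ ((2 : Cardinal.{u}) ^ K.lst)).ord n N fun p => f (N.elt p)}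

theorem mk_semSubmodels_le {S : L.Substructure M} (hS : S ∈ semSubmodels K M) : #S ≤ K.lst := by
  obtain ⟨n, -, N, f, rfl, -⟩ := hS
  exact mk_range_node_le f

theorem strongLE_of_semSubmodels {S T : L.Substructure M} (hS : S ∈ semSubmodels K M)
    (hT : T ∈ semSubmodels K M) (h : S ≤ T) : K.StrongLE S T := by
  obtain ⟨n, -, N, f, rfl, hf⟩ := hS
  obtain ⟨m, hm, N', f', rfl, hf'⟩ := hT
  exact strongLE_of_sem hm f f' h hf hf'

theorem strong_of_semSubmodels
    (h : ∀ a : Set M, #a ≤ K.lst → ∃ S ∈ semSubmodels K M, a ⊆ S)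
    {S : L.Substructure M} (hS : S ∈ semSubmodels K M) : K.Strong S :=
  strongLE_top.1 ((strongLE_of_cofinal (T := ⊤) K.lst_spec.1 (fun _ => mk_semSubmodels_le)
    (fun _ _ => le_top) (fun _ h₁ _ h₂ => strongLE_of_semSubmodels h₁ h₂)
    fun a _ ha => h a ha).1 S hS)

/-- Coherence turns inclusion between strong submodels into `≺`, so `T` is a directed union of
strong submodels and smoothness applies. -/
theorem strong_of_cofinal_strong {T : L.Substructure M}
    (h : ∀ a : Set M, a ⊆ T → #a ≤ K.lst →
      ∃ S : L.Substructure M, K.Strong S ∧ S ≤ T ∧ #S ≤ K.lst ∧ a ⊆ S) : K.Strong T :=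
  strongLE_top.1 ((strongLE_of_cofinal (D := {S | K.Strong S ∧ S ≤ T ∧ #S ≤ K.lst}) K.lst_spec.1
    (fun _ hS => hS.2.2) (fun _ hS => hS.2.1)
    (fun _ hS _ hS' hle => strongLE_of_strong hS.1 hS'.1 hle)
    fun a haT ha => (h a haT ha).imp fun _ hS => ⟨⟨hS.1, hS.2.1, hS.2.2.1⟩, hS.2.2.2⟩).2 ⊤
      fun _ hS => strongLE_top.2 hS.1)

/-- Löwenheim-Skolem gives size at most `κ`; the lower bound `hK` makes it exactly `κ`, as a node
requires. -/
theorem exists_node_one_of_mem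
    (hK : ∀ (M : Type u) [L.Structure M], K.Mem M → K.lst ≤ #M) (hM : K.Mem M)
    (A : Set M) (hA : #A ≤ K.lst) :
    ∃ (b : ShortSeq K.lst M) (N : K.Node 1) (f : N ↪[L] M),
      K.StrongEmb f ∧ A ⊆ b.rang ∧ Set.range f = b.rang := by
  obtain ⟨S, hS, hAS, hcard⟩ := K.lst_spec.2.2 hM A
  have hcard' : #S = K.lst := le_antisymm
    (hcard.trans (add_le_of_le K.lst_spec.1 hA le_rfl)) (hK _ (K.mem_of_strong _ hS).1)
  obtain ⟨N, f, hf, hr⟩ := exists_node_one hS hcard'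
  obtain ⟨b, hb⟩ := exists_rang_eq (Set.range f) (mk_range_node_le f)
  exact ⟨b, N, f, hf, by rwa [hb, hr], hb.symm⟩

theorem nonempty_of_node {n : ℕ} (hn : 0 < n) {N : K.Node n} {X : Type u} (f : N → X) :
    Nonempty X := by
  obtain ⟨ζ⟩ : Nonempty K.Idx := by
    rw [← mk_ne_zero_iff, mk_ord_toType]
    exact (aleph0_pos.trans_le K.lst_spec.1).ne'
  exact ⟨f (N.elt ⟨(0, ζ), hn⟩)⟩

theorem condB_of_strong (hK : ∀ (M : Type u) [L.Structure M], K.Mem M → K.lst ≤ #M)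
    {M₁ : L.Substructure M} (h : K.Strong M₁) (hM₁ : K.lst < #M₁) : K.CondB M₁ := by
  intro a₁ a₂ γ _
  have hM : K.lst < #M := hM₁.trans_le (mk_subtype_le _)
  obtain ⟨b₁, N₁, f₁, hf₁, ha₁, hb₁⟩ :=
    exists_node_one_of_mem hK (K.mem_of_strong _ h).1 a₁.rang (mk_rang_le a₁)
  obtain ⟨N₂, ⟨hle, g, hg, -⟩, f₂, hf₂, hf₁₂, ha₂⟩ := exists_node_extension hM
    ((strongEmb_subtype.2 h).comp hf₁) a₂.rang (mk_rang_le a₂)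
  obtain ⟨b₂, hb₂⟩ := exists_rang_eq (Set.range f₂) (mk_range_node_le f₂)
  have := nonempty_of_node one_pos f₁
  have := nonempty_of_node two_pos f₂
  refine ⟨b₁, b₂, N₁, N₂, f₁, f₂, ha₁, by rwa [hb₂], hb₁, hb₂.symm, ?_, ⟨hle, g, hg⟩,
    fun p => (hf₁₂ p).symm, satPhi_iff.2 (sem_of_strongEmb hM₁ γ hf₁),
    satPhi_iff.2 (sem_of_strongEmb hM γ hf₂)⟩
  intro y hy
  rw [← hb₁] at hy
  obtain ⟨p, rfl⟩ := hy
  rw [hb₂]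
  exact ⟨_, hf₁₂ p⟩

theorem condC_of_strong (hK : ∀ (M : Type u) [L.Structure M], K.Mem M → K.lst ≤ #M)
    {M₁ : L.Substructure M} (h : K.Strong M₁) (hM : K.lst < #M) : K.CondC M₁ := by
  intro a
  obtain ⟨b, N, f, hf, ha, hb⟩ :=
    exists_node_one_of_mem hK (K.mem_of_strong _ h).1 a.rang (mk_rang_le a)
  have := nonempty_of_node one_pos (fun y => (f y : M))
  exact ⟨b, N, f, ha, hb, satPhi_iff.2 (sem_of_strongEmb hM _ ((strongEmb_subtype.2 h).comp hf))⟩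

/-- Varying `a₂`, the images of the level-2 nodes are cofinal in `M₂`, hence strong in it. Varying
`a₁`, the images of the level-1 nodes are cofinal in `M₁`, and they are strong in `M₂` through level
2. -/
theorem strong_of_condB {M₁ : L.Substructure M} (h : K.CondB M₁) : K.Strong M₁ := by
  obtain ⟨a₀, -⟩ := exists_rang_eq (κ := K.lst) (∅ : Set M₁) (by simp)
  have hμ := ord_lt_ord.2 (succ_lt_lam (K := K))
  have hsem : ∀ {N₂ : K.Node 2} {f₂ : N₂ ↪[L] M},
      SatPhi N₂ (Order.succ ((2 : Cardinal.{u}) ^ K.lst)).ord f₂ →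
        f₂.toHom.range ∈ semSubmodels K M := by
    intro N₂ f₂ h₂
    have := nonempty_of_node two_pos f₂
    exact ⟨2, two_pos, N₂, f₂, rfl, satPhi_iff.1 h₂⟩
  have hcof : ∀ a : Set M, #a ≤ K.lst → ∃ S ∈ semSubmodels K M, a ⊆ S := by
    intro a ha
    obtain ⟨a₂, rfl⟩ := exists_rang_eq a ha
    obtain ⟨b₁, b₂, N₁, N₂, f₁, f₂, -, ha₂, -, hb₂, -, -, -, -, h₂⟩ := h a₀ a₂ _ hμ
    exact ⟨_, hsem h₂, ha₂.trans hb₂.ge⟩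
  obtain ⟨a₀', -⟩ := exists_rang_eq (κ := K.lst) (∅ : Set M) (by simp)
  refine strong_of_cofinal_strong fun a haT ha => ?_
  obtain ⟨a₁, ha₁⟩ := exists_rang_eq (κ := K.lst) ((↑) ⁻¹' a : Set M₁)
    ((mk_preimage_of_injective _ _ Subtype.val_injective).trans ha)
  obtain ⟨b₁, b₂, N₁, N₂, f₁, f₂, hab₁, -, hb₁, -, -, ⟨hle, g, hg⟩, hf, -, h₂⟩ := h a₁ a₀' _ hμ
  -- The tree condition gives this: `N₁` occupies the first block of `N₂`, which carries a
  -- `≺`-substructure of `N₂`.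
  have hstr : K.StrongEmb g := by
    obtain ⟨P, hP, hPs⟩ := N₂.strong 1 one_pos one_lt_two
    have : (g.toHom.range : L.Substructure N₂) = P := by
      refine SetLike.coe_injective (Eq.trans (Set.ext fun p => ?_) hP.symm)
      constructor
      · rintro ⟨q, rfl⟩
        have : g q = N₂.elt ⟨(q : K.Univ 1).1, (q : K.Univ 1).2.trans_le hle⟩ := hg q
        change (g q : K.Univ 2).1.1 < 1
        rw [this]
        exact (q : K.Univ 1).2
      · intro hp
        exact ⟨N₁.elt ⟨(p : K.Univ 2).1, hp⟩, hg _⟩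
    rw [StrongEmb, this]
    exact hPs
  have hcomp : f₂.comp g = M₁.subtype.comp f₁ := by
    ext p
    exact (congrArg f₂ (hg p)).trans (hf p).symm
  refine ⟨(M₁.subtype.comp f₁).toHom.range, ?_, ?_, mk_range_node_le _, fun x hx => ?_⟩
  · have := StrongEmb.comp (g := f₂) (strong_of_semSubmodels hcof (hsem h₂)) hstr
    rwa [hcomp] at this
  · rintro _ ⟨y, rfl⟩
    exact (f₁ y).2
  · have : (⟨x, haT hx⟩ : M₁) ∈ Set.range f₁ := by
      rw [hb₁]
      exact hab₁ (by rw [ha₁]; exact hx)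
    obtain ⟨y, hy⟩ := this
    exact ⟨y, congrArg Subtype.val hy⟩

/-- A single node of rank `λ + 1` makes the good submodels cofinal in all of `M₂`: its universal
quantifier ranges over `M₂`, and the extensions it provides still have rank `λ`, which is above `μ`.
The level-1 images in `M₁` are themselves good submodels of `M₂`, hence strong in it. -/
theorem strong_of_condC {M₁ : L.Substructure M} (h : K.CondC M₁) : K.Strong M₁ := by
  have hμ := (ord_lt_ord.2 (succ_lt_lam (K := K))).le
  have hcof₁ : ∀ a : Set M, a ⊆ M₁ → #a ≤ K.lst → ∃ (N : K.Node 1) (f : N ↪[L] M₁),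
      a ⊆ Set.range (M₁.subtype.comp f) ∧
        Sem M (K.lam.ord + 1) 1 N fun p => M₁.subtype.comp f (N.elt p) := by
    intro a haT ha
    obtain ⟨a₁, ha₁⟩ := exists_rang_eq (κ := K.lst) ((↑) ⁻¹' a : Set M₁)
      ((mk_preimage_of_injective _ _ Subtype.val_injective).trans ha)
    obtain ⟨b, N, f, hab, hb, hs⟩ := h a₁
    have := nonempty_of_node one_pos (fun y => (f y : M))
    refine ⟨N, f, fun x hx => ?_, satPhi_iff.1 hs⟩
    have : (⟨x, haT hx⟩ : M₁) ∈ Set.range f := by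
      rw [hb]
      exact hab (by rw [ha₁]; exact hx)
    obtain ⟨y, hy⟩ := this
    exact ⟨y, congrArg Subtype.val hy⟩
  obtain ⟨N, f, -, hN⟩ := hcof₁ ∅ (Set.empty_subset _) (by simp)
  have := nonempty_of_node one_pos (fun y => (f y : M))
  have hcof : ∀ a : Set M, #a ≤ K.lst → ∃ S ∈ semSubmodels K M, a ⊆ S := by
    intro a ha
    obtain ⟨z, hz⟩ := exists_subset_range a ha
    obtain ⟨N', -, f', -, h1, h2⟩ := sem_add_one.1 hN z
    obtain ⟨g, hg⟩ := exists_embedding_of_sem_zero (h1.mono zero_le)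
    refine ⟨g.toHom.range, ⟨2, two_pos, N', g, rfl, ?_⟩, fun x hx => ?_⟩
    · simp only [hg]
      exact h1.mono hμ
    · obtain ⟨ζ, rfl⟩ := hz hx
      obtain ⟨p, hp⟩ := h2 ζ
      exact ⟨N'.elt p, (hg p).trans hp.symm⟩
  refine strong_of_cofinal_strong fun a haT ha => ?_
  obtain ⟨N, f, haf, hs⟩ := hcof₁ a haT ha
  refine ⟨(M₁.subtype.comp f).toHom.range, strong_of_semSubmodels hcof
    ⟨1, one_pos, N, _, rfl, hs.mono (hμ.trans (Order.le_succ _))⟩, ?_, mk_range_node_le _, haf⟩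
  rintro _ ⟨y, rfl⟩
  exact (f y).2

end Conditions

end AbstractElementaryClass

theorem theorem3p1 {L : FirstOrder.Language.{u, u}} (K : AbstractElementaryClass L)
    (hK : ∀ (M : Type u) [L.Structure M], K.Mem M → K.lst ≤ #M)
    (M₂ : Type u) [L.Structure M₂] (M₁ : L.Substructure M₂) :
    (K.lst < #M₁ → [K.Strong M₁, K.CondB M₁, K.CondC M₁].TFAE) ∧
      (K.lst < #M₂ → (K.Strong M₁ ↔ K.CondC M₁)) := by
  refine ⟨fun hM₁ => ?_, fun hM₂ => ⟨fun h => AbstractElementaryClass.condC_of_strong hK h hM₂,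
    AbstractElementaryClass.strong_of_condC⟩⟩
  tfae_have 1 → 2 := fun h => AbstractElementaryClass.condB_of_strong hK h hM₁
  tfae_have 1 → 3 := fun h =>
    AbstractElementaryClass.condC_of_strong hK h (hM₁.trans_le (mk_subtype_le _))
  tfae_have 2 → 1 := AbstractElementaryClass.strong_of_condB
  tfae_have 3 → 1 := AbstractElementaryClass.strong_of_condC
  tfae_finish
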